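/- Let $n\ge 1$, $1<q\le p\le q'<\infty$ (where $q'=q/(q-1)$), $0<\rho\le 1$, $m\in\mathbb R$, and $a(\xi)=e^{i|\xi|^{1-\rho}}|\xi|^m$ on $\mathbb R^n$. Let $a(D)f(x)=(2\pi)^{-n}\int_{\mathbb R^n}e^{ix\cdot\xi}a(\xi)\hat f(\xi)\,d\xi$ with $\hat f(\xi)=\int_{\mathbb R^n} e^{-ix\cdot\xi}f(x)\,dx$. For weights $v,w$, we say that $a(D)$ is $L^q(v)$-$L^p(w)$ bounded if there is a finite constant $C$ with $$\Big(\int|a(D)f|^p\,w\,dx\Big)^{1/p}\le C\Big(\int|f|^q\,v\,dx\Big)^{1/q}$$ for all Schwartz functions $f$ for which $a\hat f$ is integrable (for $m>-n$: all Schwartz functions). Then the following hold. (i) Let $\gamma\in[1,\infty)$. If $a(D)$ is $L^q(|x|^{qs})$-$L^p(|x|^{ps})$ bounded for every $s\in(-n/\gamma,0)$ (with a constant that may depend on $s$), then $$m\le -n(1-\rho)\Big(\frac12-\frac1p\Big)-\rho n\Big(\frac1q-\frac1p\Big)-\frac{n(1-\rho)}{\gamma}.$$ (ii) Let $r\in[1,q)$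 and $t=(p/q)(r'/p)'$, where $'$ denotes the conjugate exponent (for $r=1$, $r'=\infty$ and $(r'/p)'=1$). If $a(D)$ is $L^q(\omega^q)$-$L^p(\omega^p)$ bounded for every $\omega\ge0$ with $\omega^q\in RH_t$ (with a constant that may depend on $\omega$), then $$m\le -n(1-\rho)\Big(\frac1r-\frac12\Big)-\rho n\Big(\frac1q-\frac1p\Big).$$ Here $RH_t$ is the class of locally integrable, almost everywhere positive functions $w$ with $$\sup_Q\Big(\frac1{|Q|}\int_Q w\Big)^{-1}\Big(\frac1{|Q|}\int_Q w^t\Big)^{1/t}<\infty,$$ the supremum being over all cubes $Q\subset\mathbb R^n$ with sides parallel to the axes. -/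

import Mathlib

open MeasureTheory FourierTransform SchwartzMap
open scoped ENNReal NNReal

noncomputable section

/-- The space `ℝⁿ` with its Euclidean norm. -/
abbrev Rn (n : ℕ) : Type := EuclideanSpace ℝ (Fin n)

/-- The Fourier transform `f̂(ξ) = ∫ e^{-i x·ξ} f(x) dx`; Mathlib's `𝓕` has the kernel
`e^{-2πi x·ξ}`, whence the rescaling (see `angularFourier_eq`). -/
def angularFourier {n : ℕ} (f : Rn n → ℂ) (ξ : Rn n) : ℂ :=
  𝓕 f ((2 * Real.pi)⁻¹ • ξ)

theorem angularFourier_eq {n : ℕ} (f : Rn n → ℂ) (ξ : Rn n) :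
    angularFourier f ξ =
      ∫ x : Rn n, Complex.exp (-(Complex.I * ((inner ℝ x ξ : ℝ) : ℂ))) * f x := by
  unfold angularFourier
  rw [Real.fourier_eq']
  congr 1
  ext x
  rw [smul_eq_mul, real_inner_smul_right]
  congr 2
  have : (Real.pi : ℂ) ≠ 0 := by exact_mod_cast Real.pi_ne_zero
  push_cast
  field_simp

/-- The operator `a(D)`:
`a(D) f (x) = (2π)^{-n} ∫ e^{i x·ξ} a(ξ) f̂(ξ) dξ`. -/
def multiplierOp {n : ℕ} (a : Rn n → ℂ) (f : Rn n → ℂ) (x : Rn n) : ℂ :=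
  (((2 * Real.pi) ^ n)⁻¹ : ℝ) *
    ∫ ξ : Rn n, Complex.exp (Complex.I * ((inner ℝ x ξ : ℝ) : ℂ)) * (a ξ * angularFourier f ξ)

/-- The symbol `a(ξ) = e^{i|ξ|^{1-ρ}} |ξ|^m`. -/
def oscSymbol (n : ℕ) (ρ m : ℝ) (ξ : Rn n) : ℂ :=
  Complex.exp (Complex.I * ((‖ξ‖ ^ (1 - ρ) : ℝ) : ℂ)) * ((‖ξ‖ ^ m : ℝ) : ℂ)

/-- The norm of the weighted space `L^p(w)`, that is `(∫ |f|^p w dx)^{1/p}`. -/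
def weightedNorm {n : ℕ} (p : ℝ) (w : Rn n → ℝ) (f : Rn n → ℂ) : ℝ≥0∞ :=
  eLpNorm f (ENNReal.ofReal p) (volume.withDensity fun x => ENNReal.ofReal (w x))

/-- `L^q(v)`-`L^p(w)` boundedness of `a(D)`: the estimate `‖a(D) f‖_{L^p(w)} ≤ C ‖f‖_{L^q(v)}`
for all Schwartz functions `f` for which the integral defining `a(D) f` converges absolutely
(for symbols that are locally integrable and of polynomial growth: all Schwartz functions). -/
def IsWeightedBounded {n : ℕ} (a : Rn n → ℂ) (q p : ℝ) (v w : Rn n → ℝ) : Prop :=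
  ∃ C : ℝ≥0, ∀ f : 𝓢(Rn n, ℂ), Integrable (fun ξ => a ξ * angularFourier f ξ) →
    weightedNorm p w (multiplierOp a f) ≤ C * weightedNorm q v f

/-- The cube with sides of length `ℓ` parallel to the axes and lowest corner `c`. -/
def cube {n : ℕ} (c : Rn n) (ℓ : ℝ) : Set (Rn n) :=
  {x | ∀ i, x i ∈ Set.Icc (c i) (c i + ℓ)}

/-- `⟨w⟩_{t,Q} = (|Q|⁻¹ ∫_Q w^t)^{1/t}` for a nonnegative function `w`. -/
def cubeMean {n : ℕ} (t : ℝ) (w : Rn n → ℝ) (Q : Set (Rn n)) : ℝ≥0∞ :=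
  ((volume Q)⁻¹ * ∫⁻ x in Q, ENNReal.ofReal (w x) ^ t) ^ (1 / t)

/-- The constant `[w]_{RH_t} = sup_Q ⟨w⟩_{1,Q}⁻¹ ⟨w⟩_{t,Q}`, over all cubes `Q`. -/
def rhConstant {n : ℕ} (t : ℝ) (w : Rn n → ℝ) : ℝ≥0∞ :=
  ⨆ (c : Rn n) (ℓ : ℝ) (_ : 0 < ℓ), (cubeMean 1 w (cube c ℓ))⁻¹ * cubeMean t w (cube c ℓ)

/-- The reverse Hölder class `RH_t` of weights. A weight is a locally integrable function that
is positive almost everywhere. -/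
structure IsReverseHolder {n : ℕ} (t : ℝ) (w : Rn n → ℝ) : Prop where
  locallyIntegrable : LocallyIntegrable w
  pos : ∀ᵐ x, 0 < w x
  finite : rhConstant t w < ∞

/-- The exponent `(p/q)(r'/p)'`, computed in `[0,∞]` because `r' = ∞` for `r = 1`
(and then `(r'/p)' = 1`). -/
def rhExponent (p q r : ℝ) : ℝ :=
  p / q * (ENNReal.conjExponent
    (ENNReal.conjExponent (ENNReal.ofReal r) / ENNReal.ofReal p)).toReal

end

/-! Only power weights are tested, on functions whose Fourier transform undoes the oscillation of
the symbol. Fix a unit vector `e`, a cutoff `χ` near `e`, and `φ = |η|^{1-ρ}` on its support. At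
frequency scale `R` the symbol is `R^m e^{iτ|η|^{1-ρ}} |η|^m` with `τ = R^{1-ρ}`. Let `H` be the
inverse transform of `e^{-iτφ} χ`: it has bounded `L²` norm and is spread over `|x| ≲ τ`. The test
function `F` has transform `∂_e^n (e^{-iτφ} χ)`, so `F` is `(x·e)^n H` up to a constant. The zero of
order `n` tames `|x|^s` for every `s > -n`, even where `|x|^{qs}` is not locally integrable.

The norm of `F` in `L^q(|x|^{qs})` is at most `C τ^{s+n/2+n/q}`
(`exists_weightedNorm_fourierInv_le`). The multiplier cancels the phase and leaves `R^m` times a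
polynomial in `τ` of degree `n` with fixed Schwartz coefficients, so the image is at least `c R^m
τ^n` on a fixed ball (`exists_ball_le_norm_fourierInv`). Dilating and letting `R → ∞` gives `m ≤ n/p
- n/q + (1-ρ)(s + n/q - n/2)` (`order_le_of_isWeightedBounded`).

Part (i) is the limit `s → -n/γ`. Part (ii) is part (i) with `γ = qt`: for `-n/(qt) < s < 0` the
weight `|x|^{qs}` lies in `RH_t` (`isReverseHolder_norm_rpow`), and `1/(qt) = 1/p + 1/r - 1`
(`mul_rhExponent`). -/

section OscillatoryTestFunctions

open LineDeriv
open scoped ContDiff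

/-! ### Derivatives of modulated cutoffs. -/

section Modulation

variable {E : Type*} [NormedAddCommGroup E] [NormedSpace ℝ E]

/-- The function `e^{-iτφ} χ` as a Schwartz function, for `χ` with compact support. -/
noncomputable def modulate (φ : 𝓢(E, ℝ)) (χ : 𝓢(E, ℂ)) (hχ : HasCompactSupport χ) (τ : ℝ) :
    𝓢(E, ℂ) :=
  HasCompactSupport.toSchwartzMap
    (f := fun η => Complex.exp (-(Complex.I * ((τ * φ η : ℝ) : ℂ))) * χ η) hχ.mul_left <| by
    have h1 : ContDiff ℝ ∞ (fun η => ((τ * φ η : ℝ) : ℂ)) :=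
      Complex.ofRealCLM.contDiff.comp (contDiff_const.mul (φ.smooth ⊤))
    have h2 : ContDiff ℝ ∞ χ := χ.smooth ⊤
    fun_prop

theorem modulate_apply (φ : 𝓢(E, ℝ)) (χ : 𝓢(E, ℂ)) (hχ : HasCompactSupport χ) (τ : ℝ) (η : E) :
    modulate φ χ hχ τ η = Complex.exp (-(Complex.I * ((τ * φ η : ℝ) : ℂ))) * χ η := rfl

theorem tsupport_iterate_lineDerivOp_subset (v : E) (k : ℕ) (f : 𝓢(E, ℂ)) :
    tsupport ((lineDerivOp v : 𝓢(E, ℂ) → 𝓢(E, ℂ))^[k] f) ⊆ tsupport f := by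
  induction k with
  | zero => simp
  | succ k ih =>
    rw [Function.iterate_succ_apply']
    exact (tsupport_lineDerivOp_subset v _).trans ih

theorem tsupport_modulate_subset (φ : 𝓢(E, ℝ)) (χ : 𝓢(E, ℂ)) (hχ : HasCompactSupport χ) (τ : ℝ) :
    tsupport (modulate φ χ hχ τ) ⊆ tsupport χ :=
  tsupport_mul_subset_right (f := fun η => Complex.exp (-(Complex.I * ((τ * φ η : ℝ) : ℂ))))

/-- Derivatives of `e^{-iτφ} χ` are `e^{-iτφ}` times a polynomial in `τ` whose coefficients are
Schwartz functions. -/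
theorem exists_iterate_lineDerivOp_modulate (φ : 𝓢(E, ℝ)) (χ : 𝓢(E, ℂ))
    (hχ : HasCompactSupport χ) (v : E) (k : ℕ) :
    ∃ c : ℕ → 𝓢(E, ℂ),
      (∀ η, c k η = (-(Complex.I * (fderiv ℝ φ η v : ℂ))) ^ k * χ η) ∧
      ∀ τ η, (lineDerivOp v : 𝓢(E, ℂ) → 𝓢(E, ℂ))^[k] (modulate φ χ hχ τ) η =
        Complex.exp (-(Complex.I * ((τ * φ η : ℝ) : ℂ))) *
          ∑ i ∈ Finset.range (k + 1), (τ : ℂ) ^ i * c i η := by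
  -- The induction also carries the vanishing of the coefficients beyond degree `k`, which removes
  -- the boundary terms when the sum is shifted.
  suffices h : ∃ c : ℕ → 𝓢(E, ℂ), (∀ i, k < i → c i = 0) ∧
      (∀ η, c k η = (-(Complex.I * (fderiv ℝ φ η v : ℂ))) ^ k * χ η) ∧
      ∀ τ η, (lineDerivOp v : 𝓢(E, ℂ) → 𝓢(E, ℂ))^[k] (modulate φ χ hχ τ) η =
        Complex.exp (-(Complex.I * ((τ * φ η : ℝ) : ℂ))) *
          ∑ i ∈ Finset.range (k + 1), (τ : ℂ) ^ i * c i η by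
    obtain ⟨c, -, h⟩ := h
    exact ⟨c, h⟩
  induction k with
  | zero =>
    refine ⟨fun i => if i = 0 then χ else 0, ?_, ?_, ?_⟩
    · intro i hi
      simp [hi.ne']
    · simp
    · intro τ η
      simp [modulate_apply]
  | succ k ih =>
    obtain ⟨c, hc0, hck, hc⟩ := ih
    set g : E → ℂ := fun η => -(Complex.I * ((∂_{v} φ) η : ℂ)) with hg
    have hgt : g.HasTemperateGrowth := by
      have : (fun η => Complex.ofRealCLM ((∂_{v} φ) η)).HasTemperateGrowth := by fun_prop
      have h2 : (fun _ : E => -Complex.I).HasTemperateGrowth := by fun_prop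
      have h3 := h2.mul this
      refine (congrArg Function.HasTemperateGrowth ?_).mp h3
      ext η
      simp [hg]
    have hgd : ∀ η, g η = -(Complex.I * (fderiv ℝ φ η v : ℂ)) := fun η => by
      simp only [hg, SchwartzMap.lineDerivOp_apply_eq_fderiv]
    -- Product rule: with `g = -i ∂_v φ`, the new coefficient of `τ^i` is `∂_v c_i + g c_{i-1}`,
    -- where `c_{-1} = 0`.
    refine ⟨fun i => ∂_{v} (c i) + Nat.casesOn i 0 (fun j => smulLeftCLM ℂ g (c j)), ?_, ?_, ?_⟩
    · intro i hi
      cases i with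
      | zero => omega
      | succ j => simp [hc0 (j + 1) (by omega), hc0 j (by omega), lineDerivOp_zero]
    · intro η
      simp [hc0 (k + 1) (by omega), lineDerivOp_zero, smulLeftCLM_apply_apply hgt, hck, hgd,
        pow_succ']
      ring
    · intro τ η
      rw [Function.iterate_succ_apply', SchwartzMap.lineDerivOp_apply_eq_fderiv]
      have hfun : ⇑((lineDerivOp v : 𝓢(E, ℂ) → 𝓢(E, ℂ))^[k] (modulate φ χ hχ τ)) = fun η =>
        Complex.exp (-(Complex.I * ((τ * φ η : ℝ) : ℂ))) *
          ∑ i ∈ Finset.range (k + 1), (τ : ℂ) ^ i * c i η := funext (hc τ)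
      have hφ : HasFDerivAt φ (fderiv ℝ φ η) η := φ.differentiableAt.hasFDerivAt
      have h1 : HasFDerivAt (fun η => -(Complex.I * ((τ * φ η : ℝ) : ℂ)))
          (-(Complex.I • (Complex.ofRealCLM.comp (τ • fderiv ℝ φ η)))) η :=
        ((Complex.ofRealCLM.hasFDerivAt.comp η (hφ.const_mul τ)).const_mul Complex.I).neg
      have h2 : HasFDerivAt (fun η => ∑ i ∈ Finset.range (k + 1), (τ : ℂ) ^ i * c i η)
          (∑ i ∈ Finset.range (k + 1), (τ : ℂ) ^ i • fderiv ℝ (c i) η) η :=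
        HasFDerivAt.fun_sum fun i _ => ((c i).differentiableAt.hasFDerivAt).const_mul _
      have h3 := h1.cexp.fun_mul h2
      rw [hfun, h3.fderiv, Finset.sum_range_succ' _ (k + 1)]
      have e1 : ∂_{v} (c (k + 1)) = 0 := by rw [hc0 _ (by omega), lineDerivOp_zero]
      have e2 : ∑ i ∈ Finset.range (k + 1), (τ : ℂ) ^ i * fderiv ℝ (c i) η v
          = ∑ i ∈ Finset.range (k + 1), (τ : ℂ) ^ (i + 1) * (∂_{v} (c (i + 1))) η +
            (∂_{v} (c 0)) η := by
        conv_rhs => rw [Finset.sum_range_succ _ k, e1]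
        rw [Finset.sum_range_succ' _ k]
        simp [SchwartzMap.lineDerivOp_apply_eq_fderiv]
      have e3 : ∑ i ∈ Finset.range (k + 1), (τ : ℂ) ^ (i + 1) * (g η * c i η) =
          (τ * g η) * ∑ i ∈ Finset.range (k + 1), (τ : ℂ) ^ i * c i η := by
        rw [Finset.mul_sum]
        exact Finset.sum_congr rfl fun i _ => by ring
      simp only [hgd] at e3
      simp only [add_apply, smul_apply, _root_.neg_apply, _root_.sum_apply,
        ContinuousLinearMap.comp_apply, smul_eq_mul, Complex.ofRealCLM_apply,
        smulLeftCLM_apply_apply hgt, e2, mul_add, Finset.sum_add_distrib, hgd, e3]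
      push_cast
      simp
      ring

end Modulation

/-! ### `L²` moments through Plancherel. -/

section Moments

variable {V : Type*} [NormedAddCommGroup V] [InnerProductSpace ℝ V] [FiniteDimensional ℝ V]
  [MeasurableSpace V] [BorelSpace V]

theorem fourierInv_iterate_lineDerivOp (f : 𝓢(V, ℂ)) (v : V) (k : ℕ) (x : V) :
    (𝓕⁻ ((lineDerivOp v : 𝓢(V, ℂ) → 𝓢(V, ℂ))^[k] f)) x =
      (-(2 * Real.pi * Complex.I) * (inner ℝ x v : ℝ)) ^ k * (𝓕⁻ f) x := by
  have hv : (inner ℝ · v).HasTemperateGrowth := by fun_prop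
  induction k with
  | zero => simp
  | succ k ih =>
    rw [Function.iterate_succ_apply', fourierInv_lineDerivOp_eq]
    simp only [smul_apply, smulLeftCLM_apply_apply hv, ih, smul_eq_mul, Complex.real_smul]
    ring

theorem integral_norm_sq_fourierInv (f : 𝓢(V, ℂ)) : ∫ x, ‖(𝓕⁻ f) x‖ ^ 2 = ∫ x, ‖f x‖ ^ 2 := by
  rw [← integral_norm_sq_fourier (𝓕⁻ f), fourier_fourierInv_eq]

theorem integrable_norm_sq (f : 𝓢(V, ℂ)) : Integrable fun x => ‖f x‖ ^ 2 := by
  have := (f.memLp 2 volume).integrable_norm_pow (by norm_num)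
  simpa using this

/-- By Plancherel this is an `L²` bound on the `k`-th derivative, a polynomial in `τ` of degree `k`
times a unimodular factor; Cauchy–Schwarz over its `k + 1` terms gives the constant. -/
theorem exists_lintegral_fourierInv_modulate_le (φ : 𝓢(V, ℝ)) (χ : 𝓢(V, ℂ))
    (hχ : HasCompactSupport χ) (v : V) (k : ℕ) :
    ∃ C : ℝ, 0 ≤ C ∧ ∀ τ : ℝ, 1 ≤ τ →
      ∫⁻ x, ENNReal.ofReal
        (‖(𝓕⁻ ((lineDerivOp v : 𝓢(V, ℂ) → 𝓢(V, ℂ))^[k] (modulate φ χ hχ τ))) x‖ ^ 2) ≤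
        ENNReal.ofReal (C * τ ^ (2 * k)) := by
  obtain ⟨c, -, hc⟩ := exists_iterate_lineDerivOp_modulate φ χ hχ v k
  refine ⟨∫ η, (k + 1) * ∑ i ∈ Finset.range (k + 1), ‖c i η‖ ^ 2,
    integral_nonneg fun η => by positivity, fun τ hτ => ?_⟩
  rw [← ofReal_integral_eq_lintegral_ofReal (integrable_norm_sq _)
    (Filter.Eventually.of_forall fun x => by positivity), integral_norm_sq_fourierInv]
  refine ENNReal.ofReal_le_ofReal ?_
  rw [← integral_mul_const]
  refine integral_mono (integrable_norm_sq _) ?_ fun η => ?_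
  · exact ((integrable_finsetSum _ fun i _ => integrable_norm_sq (c i)).const_mul _).mul_const _
  · have h1 : ‖(lineDerivOp v : 𝓢(V, ℂ) → 𝓢(V, ℂ))^[k] (modulate φ χ hχ τ) η‖ ≤
        τ ^ k * ∑ i ∈ Finset.range (k + 1), ‖c i η‖ := by
      rw [hc, norm_mul]
      have : ‖Complex.exp (-(Complex.I * ((τ * φ η : ℝ) : ℂ)))‖ = 1 := by
        rw [mul_comm, ← neg_mul, ← Complex.ofReal_neg, Complex.norm_exp_ofReal_mul_I]
      rw [this, one_mul, Finset.mul_sum]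
      refine (norm_sum_le _ _).trans (Finset.sum_le_sum fun i hi => ?_)
      rw [norm_mul, norm_pow, Complex.norm_real, Real.norm_of_nonneg (by linarith)]
      gcongr
      have := Finset.mem_range.mp hi
      omega
    have h2 := sq_sum_le_card_mul_sum_sq (s := Finset.range (k + 1)) (f := fun i => ‖c i η‖)
    simp only [Finset.card_range, Nat.cast_add, Nat.cast_one] at h2
    calc _ ≤ (τ ^ k * ∑ i ∈ Finset.range (k + 1), ‖c i η‖) ^ 2 := by gcongr
      _ = (∑ i ∈ Finset.range (k + 1), ‖c i η‖) ^ 2 * τ ^ (2 * k) := by ring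
      _ ≤ _ := by gcongr

end Moments

/-- The power mean inequality for the numbers `x_j²`; it reduces radial moments to moments in the
coordinate directions. -/
theorem norm_pow_le_sum_pow {n : ℕ} (x : Rn n) (k : ℕ) :
    ‖x‖ ^ (2 * (k + 1)) ≤ (n : ℝ) ^ k * ∑ j, x j ^ (2 * (k + 1)) := by
  rcases Nat.eq_zero_or_pos n with rfl | hn
  · have : x = 0 := Subsingleton.elim _ _
    simp [this]
  have h2 := pow_sum_div_card_le_sum_pow (s := Finset.univ) (f := fun j => x j ^ 2)
    (fun j _ => sq_nonneg _) (n := k)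
  rw [Finset.card_univ, Fintype.card_fin, div_le_iff₀ (by positivity)] at h2
  rw [pow_mul, EuclideanSpace.real_norm_sq_eq, mul_comm]
  simpa only [← pow_mul] using h2

/-- Weighted `L²` bound for the inverse Fourier transform of `e^{-iτφ} χ`: it lives at scale `τ`. -/
theorem exists_lintegral_weight_fourierInv_modulate_le {n : ℕ} (φ : 𝓢(Rn n, ℝ)) (χ : 𝓢(Rn n, ℂ))
    (hχ : HasCompactSupport χ) (k : ℕ) :
    ∃ C : ℝ, 0 ≤ C ∧ ∀ τ : ℝ, 1 ≤ τ →
      ∫⁻ x, ENNReal.ofReal ((1 + ‖x‖ / τ) ^ (2 * (k + 1)) * ‖(𝓕⁻ (modulate φ χ hχ τ)) x‖ ^ 2) ≤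
        ENNReal.ofReal C := by
  obtain ⟨C₀, hC₀, h₀⟩ := exists_lintegral_fourierInv_modulate_le φ χ hχ 0 0
  choose C₁ hC₁ h₁ using fun j : Fin n =>
    exists_lintegral_fourierInv_modulate_le φ χ hχ (EuclideanSpace.single j 1) (k + 1)
  refine ⟨2 ^ (2 * (k + 1)) * (C₀ + n ^ k * ∑ j, C₁ j), by
    have := Finset.sum_nonneg fun j (_ : j ∈ Finset.univ) => hC₁ j
    positivity, fun τ hτ => ?_⟩
  have hτ0 : 0 < τ := by linarith
  set H := 𝓕⁻ (modulate φ χ hχ τ) with hH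
  set D : Fin n → 𝓢(Rn n, ℂ) := fun j => 𝓕⁻ ((lineDerivOp (EuclideanSpace.single j (1 : ℝ)) :
    𝓢(Rn n, ℂ) → 𝓢(Rn n, ℂ))^[k + 1] (modulate φ χ hχ τ)) with hD
  have hpt : ∀ x, (1 + ‖x‖ / τ) ^ (2 * (k + 1)) * ‖H x‖ ^ 2 ≤
      2 ^ (2 * (k + 1)) * (‖H x‖ ^ 2 +
        n ^ k * ∑ j, (τ ^ (2 * (k + 1)))⁻¹ * ‖D j x‖ ^ 2) := by
    intro x
    -- Differentiating `k + 1` times along the `j`-th axis multiplies `H` by `(-2πi x_j)^{k+1}`; the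
    -- factor `2π ≥ 1` is discarded.
    have hj : ∀ j, x j ^ (2 * (k + 1)) * ‖H x‖ ^ 2 ≤ ‖D j x‖ ^ 2 := by
      intro j
      have : D j x = (-(2 * Real.pi * Complex.I) * (x j : ℝ)) ^ (k + 1) * H x := by
        rw [hD, fourierInv_iterate_lineDerivOp, EuclideanSpace.inner_single_right]
        simp [hH]
      rw [this, norm_mul, mul_pow, norm_pow, norm_mul, norm_neg, norm_mul, norm_mul,
        Complex.norm_I, Complex.norm_real, Complex.norm_real, Complex.norm_ofNat,
        Real.norm_of_nonneg Real.pi_pos.le, ← pow_mul, mul_comm (k + 1) 2, mul_pow,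
        Real.norm_eq_abs, (even_two_mul (k + 1)).pow_abs]
      have h1 : (1 : ℝ) ≤ (2 * Real.pi * 1) ^ (2 * (k + 1)) :=
        one_le_pow₀ (by nlinarith [Real.pi_gt_three])
      have h2 : 0 ≤ x j ^ (2 * (k + 1)) := (even_two_mul (k + 1)).pow_nonneg _
      nlinarith [mul_nonneg h2 (sq_nonneg ‖H x‖)]
    have h1 : (1 + ‖x‖ / τ) ^ (2 * (k + 1)) ≤
        2 ^ (2 * (k + 1)) * (1 + (‖x‖ / τ) ^ (2 * (k + 1))) := by
      have hmax : 1 + ‖x‖ / τ ≤ 2 * max 1 (‖x‖ / τ) := by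
        have := le_max_left 1 (‖x‖ / τ)
        have := le_max_right 1 (‖x‖ / τ)
        linarith
      calc _ ≤ (2 * max 1 (‖x‖ / τ)) ^ (2 * (k + 1)) := by gcongr
        _ = 2 ^ (2 * (k + 1)) * (max 1 (‖x‖ / τ)) ^ (2 * (k + 1)) := mul_pow _ _ _
        _ ≤ _ := by
          gcongr
          rcases max_cases 1 (‖x‖ / τ) with h | h <;> rw [h.1]
          · have : 0 ≤ (‖x‖ / τ) ^ (2 * (k + 1)) := by positivity
            simpa using this
          · simp
    have h2 : (‖x‖ / τ) ^ (2 * (k + 1)) * ‖H x‖ ^ 2 ≤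
        n ^ k * ∑ j, (τ ^ (2 * (k + 1)))⁻¹ * ‖D j x‖ ^ 2 := by
      rw [div_pow, div_eq_inv_mul, ← Finset.mul_sum]
      calc _ ≤ (τ ^ (2 * (k + 1)))⁻¹ * ((n : ℝ) ^ k * ∑ j, x j ^ (2 * (k + 1))) * ‖H x‖ ^ 2 := by
            gcongr
            exact norm_pow_le_sum_pow x k
        _ = n ^ k * ((τ ^ (2 * (k + 1)))⁻¹ * ∑ j, x j ^ (2 * (k + 1)) * ‖H x‖ ^ 2) := by
            rw [← Finset.sum_mul]; ring
        _ ≤ _ := by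
            gcongr with j
            exact hj j
    calc _ ≤ 2 ^ (2 * (k + 1)) * (1 + (‖x‖ / τ) ^ (2 * (k + 1))) * ‖H x‖ ^ 2 := by gcongr
      _ = 2 ^ (2 * (k + 1)) * (‖H x‖ ^ 2 + (‖x‖ / τ) ^ (2 * (k + 1)) * ‖H x‖ ^ 2) := by ring
      _ ≤ _ := by gcongr
  have hmain : ∀ f : 𝓢(Rn n, ℂ), ∀ B, 0 ≤ B → ∫⁻ x, ENNReal.ofReal (‖f x‖ ^ 2) ≤ ENNReal.ofReal B →
      ∫ x, ‖f x‖ ^ 2 ≤ B := by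
    intro f B hB h
    rw [← ofReal_integral_eq_lintegral_ofReal (integrable_norm_sq f)
      (Filter.Eventually.of_forall fun x => by positivity)] at h
    exact (ENNReal.ofReal_le_ofReal_iff hB).mp h
  have hI : Integrable fun x => 2 ^ (2 * (k + 1)) * (‖H x‖ ^ 2 +
        n ^ k * ∑ j, (τ ^ (2 * (k + 1)))⁻¹ * ‖D j x‖ ^ 2) :=
    ((integrable_norm_sq H).add ((integrable_finsetSum _ fun j _ =>
      (integrable_norm_sq (D j)).const_mul _).const_mul _)).const_mul _
  refine (lintegral_mono fun x => ENNReal.ofReal_le_ofReal (hpt x)).trans ?_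
  rw [← ofReal_integral_eq_lintegral_ofReal hI
    (Filter.Eventually.of_forall fun x => by positivity)]
  refine ENNReal.ofReal_le_ofReal ?_
  rw [integral_const_mul, integral_add (integrable_norm_sq H) ((integrable_finsetSum _ fun j _ =>
      (integrable_norm_sq (D j)).const_mul _).const_mul _), integral_const_mul,
      integral_finsetSum _ fun j _ => (integrable_norm_sq (D j)).const_mul _]
  gcongr with j
  · exact hmain _ _ hC₀ (by simpa using h₀ τ hτ)
  · rw [integral_const_mul, inv_mul_le_iff₀ (by positivity), mul_comm]
    exact hmain _ _ (mul_nonneg (hC₁ j) (by positivity)) (h₁ j τ hτ)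

/-! ### Dilations and the multiplier. -/

section Scaling

variable {n : ℕ}

theorem angularFourier_comp_smul (F : Rn n → ℂ) {c : ℝ} (hc : 0 < c) (ξ : Rn n) :
    angularFourier (fun x => F (c • x)) ξ =
      ((c ^ n)⁻¹ : ℝ) * 𝓕 F ((2 * Real.pi * c)⁻¹ • ξ) := by
  rw [angularFourier_eq, Real.fourier_eq']
  have h := Measure.integral_comp_smul_of_nonneg (volume : Measure (Rn n))
    (fun y => Complex.exp (-(Complex.I * ((c⁻¹ * inner ℝ y ξ : ℝ) : ℂ))) * F y) c (hR := hc.le)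
  rw [finrank_euclideanSpace_fin, Complex.real_smul] at h
  convert! h using 3 with x
  · rw [real_inner_smul_left, inv_mul_cancel_left₀ hc.ne']
  · ext x
    rw [smul_eq_mul, real_inner_smul_right]
    congr 2
    have : (Real.pi : ℂ) ≠ 0 := by exact_mod_cast Real.pi_ne_zero
    have : (c : ℂ) ≠ 0 := by exact_mod_cast hc.ne'
    push_cast
    field_simp

/-- Dilation by `c` evaluates the symbol at scale `2πc`, the `2π` coming from the two Fourier
normalisations; hence the later choice `c = R/(2π)`. -/
theorem multiplierOp_comp_smul (a F : Rn n → ℂ) {c : ℝ} (hc : 0 < c) (x : Rn n) :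
    multiplierOp a (fun x => F (c • x)) x =
      𝓕⁻ (fun η => a ((2 * Real.pi * c) • η) * 𝓕 F η) (c • x) := by
  have hR : 0 < 2 * Real.pi * c := by positivity
  have h := Measure.integral_comp_smul_of_nonneg (volume : Measure (Rn n))
    (fun ξ => Complex.exp (Complex.I * ((inner ℝ x ξ : ℝ) : ℂ)) *
      (a ξ * 𝓕 F ((2 * Real.pi * c)⁻¹ • ξ))) (2 * Real.pi * c) (hR := hR.le)
  rw [finrank_euclideanSpace_fin, Complex.real_smul] at h
  rw [multiplierOp, Real.fourierInv_eq']
  simp_rw [angularFourier_comp_smul F hc]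
  have e1 : ∀ ξ : Rn n, Complex.exp (Complex.I * ((inner ℝ x ξ : ℝ) : ℂ)) *
      (a ξ * (((c ^ n)⁻¹ : ℝ) * 𝓕 F ((2 * Real.pi * c)⁻¹ • ξ))) =
      ((c ^ n)⁻¹ : ℝ) * (Complex.exp (Complex.I * ((inner ℝ x ξ : ℝ) : ℂ)) *
      (a ξ * 𝓕 F ((2 * Real.pi * c)⁻¹ • ξ))) := fun ξ => by ring
  simp_rw [e1]
  rw [integral_const_mul, ← mul_assoc, ← Complex.ofReal_mul, ← mul_inv, ← mul_pow, ← h]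
  congr 1
  ext η
  rw [inv_smul_smul₀ hR.ne', real_inner_smul_right, real_inner_smul_right, smul_eq_mul,
    real_inner_comm]
  congr 2
  push_cast
  ring

end Scaling

/-! ### Cutoffs near a unit vector and lower bounds. -/

section Cutoff

variable {V : Type*} [NormedAddCommGroup V] [InnerProductSpace ℝ V]

theorem half_le_norm_of_mem_closedBall {W : Type*} [NormedAddCommGroup W] {e η : W} (he : ‖e‖ = 1)
    (hη : η ∈ Metric.closedBall e (1 / 2)) : 1 / 2 ≤ ‖η‖ := by
  rw [mem_closedBall_iff_norm'] at hη
  have := norm_sub_norm_le e η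
  linarith

theorem half_le_inner_of_mem_closedBall {e η : V} (he : ‖e‖ = 1)
    (hη : η ∈ Metric.closedBall e (1 / 2)) : 1 / 2 ≤ inner ℝ η e := by
  rw [mem_closedBall_iff_norm] at hη
  have h1 : inner ℝ η e = inner ℝ (η - e) e + 1 := by
    rw [inner_sub_left, real_inner_self_eq_norm_sq, he]
    ring
  have h2 := (abs_le.mp (abs_real_inner_le_norm (η - e) e)).1
  rw [he, mul_one] at h2
  linarith

/-- Away from the origin, `|η|^a` agrees with a Schwartz function. -/
theorem exists_schwartz_eq_norm_rpow [FiniteDimensional ℝ V] {e : V} (he : ‖e‖ = 1) (a : ℝ) :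
    ∃ g : 𝓢(V, ℝ), ∀ η ∈ Metric.closedBall e (1 / 2), g η = ‖η‖ ^ a := by
  let B : ContDiffBump e := ⟨1 / 2, 3 / 4, by norm_num, by norm_num⟩
  have hs : ContDiff ℝ ∞ (fun η => B η * ‖η‖ ^ a) := by
    rw [contDiff_iff_contDiffAt]
    intro η
    by_cases h0 : η = 0
    · have : (fun η => B η * ‖η‖ ^ a) =ᶠ[nhds η] fun _ => 0 := by
        have hmem : (Metric.closedBall e (3 / 4))ᶜ ∈ nhds η := by
          refine Metric.isClosed_closedBall.isOpen_compl.mem_nhds ?_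
          simp only [h0, Set.mem_compl_iff, mem_closedBall_iff_norm, zero_sub, norm_neg, he]
          norm_num
        filter_upwards [hmem] with y hy
        have : B y = 0 := by
          refine B.zero_of_le_dist ?_
          rw [Set.mem_compl_iff, Metric.mem_closedBall, not_le] at hy
          exact hy.le
        rw [this, zero_mul]
      exact contDiffAt_const.congr_of_eventuallyEq this
    · exact B.contDiff.contDiffAt.mul
        ((contDiffAt_norm ℝ h0).rpow_const_of_ne (norm_ne_zero_iff.mpr h0))
  refine ⟨HasCompactSupport.toSchwartzMap (B.hasCompactSupport.mul_right) hs, fun η hη => ?_⟩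
  have : B η = 1 := B.one_of_mem_closedBall hη
  simp [this]

/-- A nonnegative cutoff around `e`. -/
theorem exists_schwartz_cutoff [FiniteDimensional ℝ V] (e : V) :
    ∃ χ : 𝓢(V, ℂ), HasCompactSupport χ ∧ tsupport χ ⊆ Metric.closedBall e (1 / 2) ∧
      (∀ η, η ∉ Metric.ball e (1 / 2) → χ η = 0) ∧
      ∃ χ' : V → ℝ, (∀ η, χ η = χ' η) ∧ (∀ η, 0 ≤ χ' η) ∧ χ' e = 1 := by
  let B : ContDiffBump e := ⟨1 / 4, 1 / 2, by norm_num, by norm_num⟩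
  have hs : ContDiff ℝ ∞ (fun η => ((B η : ℝ) : ℂ)) :=
    Complex.ofRealCLM.contDiff.comp B.contDiff
  have hz : ∀ η, η ∉ Metric.ball e (1 / 2) → B η = 0 := fun η hη =>
    B.zero_of_le_dist (not_lt.mp hη)
  have hts : tsupport (fun η => ((B η : ℝ) : ℂ)) ⊆ Metric.closedBall e (1 / 2) := by
    refine closure_minimal (fun η hη => ?_) Metric.isClosed_closedBall
    by_contra hc
    refine hη ?_
    simp [hz η fun h => hc (Metric.ball_subset_closedBall h)]
  have hc : HasCompactSupport (fun η => ((B η : ℝ) : ℂ)) :=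
    HasCompactSupport.of_support_subset_isCompact (isCompact_closedBall e (1 / 2))
      ((subset_tsupport _).trans hts)
  refine ⟨hc.toSchwartzMap hs, hc, hts, fun η hη => ?_, B, fun η => rfl, fun η => B.nonneg, ?_⟩
  · simp [hz η hη]
  · exact B.one_of_mem_closedBall (Metric.mem_closedBall_self (by norm_num))

/-- Gives the leading coefficient of the image a constant phase, so that its integral cannot cancel.
-/
theorem fderiv_norm_rpow_apply_pos {a : ℝ} (ha : 0 < a) {η e : V} (hη : η ≠ 0)
    (h : 0 < inner ℝ η e) : 0 < fderiv ℝ (fun x : V => ‖x‖ ^ a) η e := by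
  have h0 : 0 < ‖η‖ ^ 2 := by positivity
  have h1 : HasFDerivAt (fun x : V => (‖x‖ ^ 2) ^ (a / 2))
      ((a / 2 * (‖η‖ ^ 2) ^ (a / 2 - 1)) • (2 • innerSL ℝ η)) η :=
    (hasStrictFDerivAt_norm_sq η).hasFDerivAt.rpow_const (Or.inl h0.ne')
  have h2 : (fun x : V => ‖x‖ ^ a) = fun x : V => (‖x‖ ^ 2) ^ (a / 2) := by
    ext x
    rw [← Real.rpow_natCast, ← Real.rpow_mul (norm_nonneg _)]
    congr 1
    push_cast
    ring
  rw [h2, h1.fderiv]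
  simp only [smul_apply, innerSL_apply_apply, smul_eq_mul, nsmul_eq_mul]
  positivity

theorem exists_ball_norm_ge_of_ne_zero {W : Type*} [NormedAddCommGroup W] {G : W → ℂ}
    (hG : Continuous G) {x₀ : W}
    (h : G x₀ ≠ 0) : ∃ δ > 0, ∀ x ∈ Metric.ball x₀ δ, ‖G x₀‖ / 2 ≤ ‖G x‖ := by
  have hpos : 0 < ‖G x₀‖ := norm_pos_iff.mpr h
  have := (hG.norm.continuousAt (x := x₀)).eventually (lt_mem_nhds (half_lt_self hpos))
  obtain ⟨δ, hδ, hb⟩ := Metric.eventually_nhds_iff_ball.mp this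
  exact ⟨δ, hδ, fun x hx => (hb x hx).le⟩

/-- A polynomial in `τ` with Schwartz coefficients is dominated by its leading term. -/
theorem exists_ball_le_norm_sum (D : ℕ → 𝓢(V, ℂ)) (k : ℕ) {x₀ : V} (h : D k x₀ ≠ 0) :
    ∃ δ > 0, ∃ c > 0, ∃ T ≥ (1 : ℝ), ∀ τ ≥ T, ∀ x ∈ Metric.ball x₀ δ,
      c * τ ^ k ≤ ‖∑ i ∈ Finset.range (k + 1), (τ : ℂ) ^ i * D i x‖ := by
  obtain ⟨δ, hδ, hb⟩ := exists_ball_norm_ge_of_ne_zero (D k).continuous h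
  have hpos : 0 < ‖D k x₀‖ := norm_pos_iff.mpr h
  choose M hM0 hM using fun i => (D i).decay 0 0
  set S := ∑ i ∈ Finset.range k, M i with hS
  have hS0 : 0 ≤ S := Finset.sum_nonneg fun i _ => (hM0 i).le
  -- On the ball the leading term is at least `‖D k x₀‖/2 · τ^k`. Beyond the threshold the lower
  -- terms, of total size at most `τ^{k-1} S`, consume at most half of that.
  refine ⟨δ, hδ, ‖D k x₀‖ / 4, by positivity, max 1 (S / (‖D k x₀‖ / 4)), le_max_left _ _, ?_⟩
  intro τ hτ x hx
  have hτ1 : 1 ≤ τ := (le_max_left _ _).trans hτ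
  have hτS : S ≤ ‖D k x₀‖ / 4 * τ := by
    have := (le_max_right _ _).trans hτ
    rwa [div_le_iff₀ (by positivity), mul_comm] at this
  have h1 : ‖∑ i ∈ Finset.range k, (τ : ℂ) ^ i * D i x‖ ≤ ‖D k x₀‖ / 4 * τ ^ k := by
    rcases Nat.eq_zero_or_pos k with rfl | hk
    · simpa using by positivity
    · calc _ ≤ ∑ i ∈ Finset.range k, τ ^ (k - 1) * M i := by
            refine (norm_sum_le _ _).trans (Finset.sum_le_sum fun i hi => ?_)
            rw [norm_mul, norm_pow, Complex.norm_real, Real.norm_of_nonneg (by linarith)]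
            have := hM i x
            simp only [pow_zero, norm_iteratedFDeriv_zero, one_mul] at this
            have hi' := Finset.mem_range.mp hi
            gcongr
            omega
        _ = τ ^ (k - 1) * S := by rw [Finset.mul_sum]
        _ ≤ τ ^ (k - 1) * (‖D k x₀‖ / 4 * τ) := by gcongr
        _ = ‖D k x₀‖ / 4 * τ ^ k := by
            obtain ⟨j, rfl⟩ : ∃ j, k = j + 1 := ⟨k - 1, by omega⟩
            simp only [Nat.add_sub_cancel]
            ring
  have h2 : ‖(τ : ℂ) ^ k * D k x‖ ≥ ‖D k x₀‖ / 2 * τ ^ k := by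
    rw [norm_mul, norm_pow, Complex.norm_real, Real.norm_of_nonneg (by linarith), mul_comm]
    gcongr
    exact hb x hx
  rw [Finset.sum_range_succ, add_comm]
  have h3 := norm_sub_le_norm_add ((τ : ℂ) ^ k * D k x) (∑ i ∈ Finset.range k, (τ : ℂ) ^ i * D i x)
  linarith

end Cutoff

/-! ### Injectivity of directional derivatives. -/

section Nonvanishing

variable {V : Type*} [NormedAddCommGroup V] [InnerProductSpace ℝ V] [FiniteDimensional ℝ V]
  [MeasurableSpace V] [BorelSpace V]

/-- The inverse transform is killed by `(x·e)^k`, so it vanishes off a hyperplane, and on it by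
continuity along lines parallel to `e`. -/
theorem eq_zero_of_iterate_lineDerivOp_eq_zero {f : 𝓢(V, ℂ)} {e : V} (he : ‖e‖ = 1) {k : ℕ}
    (h : (lineDerivOp e : 𝓢(V, ℂ) → 𝓢(V, ℂ))^[k] f = 0) : f = 0 := by
  have h1 : ∀ x, inner ℝ x e ≠ 0 → (𝓕⁻ f) x = 0 := by
    intro x hx
    have h2 := fourierInv_iterate_lineDerivOp f e k x
    rw [h] at h2
    have h3 : (𝓕⁻ (0 : 𝓢(V, ℂ))) x = 0 := by
      rw [FourierTransform.fourierInv_zero]; rfl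
    rw [h3] at h2
    have h4 : (-(2 * Real.pi * Complex.I) * (inner ℝ x e : ℝ)) ^ k ≠ 0 := by
      refine pow_ne_zero _ (mul_ne_zero (by simp [Real.pi_ne_zero]) (by exact_mod_cast hx))
    exact (mul_eq_zero.mp h2.symm).resolve_left h4
  have h5 : 𝓕⁻ f = 0 := by
    ext x
    have hc : Continuous fun t : ℝ => (𝓕⁻ f) (x + t • e) :=
      (𝓕⁻ f).continuous.comp (by fun_prop)
    have := Continuous.ext_on (dense_compl_singleton (-(inner ℝ x e : ℝ))) hc
      (continuous_const (y := (0 : ℂ))) fun t ht => h1 _ ?_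
    · simpa using congrFun this 0
    · rw [inner_add_left, real_inner_smul_left, real_inner_self_eq_norm_sq, he]
      intro h0
      exact ht (by simp only [Set.mem_singleton_iff]; linarith)
  have h6 := congrArg (fun g : 𝓢(V, ℂ) => 𝓕 g) h5
  simpa using h6

end Nonvanishing

/-! ### Norms with power weights. -/

section WeightedNorm

variable {n : ℕ}

theorem measurable_ofReal_norm_rpow (a : ℝ) :
    Measurable fun x : Rn n => ENNReal.ofReal (‖x‖ ^ a) := by fun_prop

theorem weightedNorm_eq_lintegral {p : ℝ} (hp : 0 < p) (a : ℝ) (f : Rn n → ℂ) :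
    weightedNorm p (fun x => ‖x‖ ^ a) f =
      (∫⁻ x, ENNReal.ofReal (‖x‖ ^ a) * ‖f x‖ₑ ^ p) ^ (1 / p) := by
  rw [weightedNorm, eLpNorm_eq_lintegral_rpow_enorm_toReal (by simpa using hp) (by simp),
    ENNReal.toReal_ofReal hp.le,
    lintegral_withDensity_eq_lintegral_mul_non_measurable _ (measurable_ofReal_norm_rpow a)
      (Filter.Eventually.of_forall fun x => ENNReal.ofReal_lt_top)]
  rfl

theorem lintegral_comp_smul {c : ℝ} (hc : 0 < c) (g : Rn n → ℝ≥0∞) :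
    ∫⁻ x, g (c • x) = ENNReal.ofReal (c ^ (-(n : ℝ))) * ∫⁻ x, g x := by
  have h := lintegral_map_equiv (μ := volume) g
    (Homeomorph.smulOfNeZero (α := Rn n) c hc.ne').toMeasurableEquiv
  have h2 : Measure.map (Homeomorph.smulOfNeZero (α := Rn n) c hc.ne').toMeasurableEquiv volume
      = ENNReal.ofReal |(c ^ Module.finrank ℝ (Rn n))⁻¹| • (volume : Measure (Rn n)) :=
    Measure.map_addHaar_smul volume hc.ne'
  rw [h2, lintegral_smul_measure] at h
  refine Eq.trans h.symm ?_
  rw [finrank_euclideanSpace_fin, abs_of_pos (by positivity), Real.rpow_neg hc.le,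
    Real.rpow_natCast]
  rfl

/-- Scaling of the norm of `L^p(|x|^{ps})`. -/
theorem weightedNorm_comp_smul {p : ℝ} (hp : 0 < p) (s : ℝ) (f : Rn n → ℂ) {c : ℝ} (hc : 0 < c) :
    weightedNorm p (fun x => ‖x‖ ^ (p * s)) (fun x => f (c • x)) =
      ENNReal.ofReal (c ^ (-(n : ℝ) / p - s)) * weightedNorm p (fun x => ‖x‖ ^ (p * s)) f := by
  rw [weightedNorm_eq_lintegral hp, weightedNorm_eq_lintegral hp]
  have h1 : ∀ x : Rn n, ENNReal.ofReal (‖x‖ ^ (p * s)) * ‖f (c • x)‖ₑ ^ p =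
      (fun y => ENNReal.ofReal (c ^ (-(p * s))) * (ENNReal.ofReal (‖y‖ ^ (p * s)) * ‖f y‖ₑ ^ p))
        (c • x) := by
    intro x
    simp only
    rw [← mul_assoc, ← ENNReal.ofReal_mul (by positivity), norm_smul, Real.norm_of_nonneg hc.le,
      Real.mul_rpow hc.le (norm_nonneg _), ← mul_assoc, ← Real.rpow_add hc, neg_add_cancel,
      Real.rpow_zero, one_mul]
  rw [lintegral_congr h1, lintegral_comp_smul hc (fun y : Rn n =>
      ENNReal.ofReal (c ^ (-(p * s))) * (ENNReal.ofReal (‖y‖ ^ (p * s)) * ‖f y‖ₑ ^ p)), lintegral_const_mul' _ _ ENNReal.ofReal_ne_top, ← mul_assoc,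
    ← ENNReal.ofReal_mul (by positivity), ENNReal.mul_rpow_of_nonneg _ _ (by positivity),
    ENNReal.ofReal_rpow_of_nonneg (by positivity) (by positivity), ← Real.rpow_add hc,
    ← Real.rpow_mul hc.le]
  congr 3
  field_simp
  ring

/-- A lower bound on a ball gives a lower bound for the norm of `L^p(|x|^a)`. -/
theorem exists_le_weightedNorm {p : ℝ} (hp : 0 < p) (a : ℝ) (hn : 1 ≤ n) (x₀ : Rn n) {δ : ℝ}
    (hδ : 0 < δ) : ∃ κ : ℝ, 0 < κ ∧ ∀ (A : ℝ) (f : Rn n → ℂ), 0 ≤ A →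
      (∀ x ∈ Metric.ball x₀ δ, A ≤ ‖f x‖) →
      ENNReal.ofReal (A * κ) ≤ weightedNorm p (fun x => ‖x‖ ^ a) f := by
  have : Nonempty (Fin n) := ⟨⟨0, hn⟩⟩
  set I := ∫⁻ x in Metric.ball x₀ δ, ENNReal.ofReal (‖x‖ ^ a) with hI
  have hI0 : 0 < I := by
    rw [hI, setLIntegral_pos_iff (measurable_ofReal_norm_rpow a)]
    refine lt_of_lt_of_le (b := volume (Metric.ball x₀ δ \ {0})) ?_ (measure_mono ?_)
    · rw [measure_sdiff_null (measure_singleton _)]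
      exact Metric.measure_ball_pos _ _ hδ
    · rintro x ⟨hx, hx0⟩
      refine ⟨?_, hx⟩
      have : 0 < ‖x‖ := norm_pos_iff.mpr hx0
      simp only [Function.mem_support, ne_eq, ENNReal.ofReal_eq_zero, not_le]
      positivity
  -- The weight may fail to be integrable near the origin, so `I` may be infinite; a finite positive
  -- `κ` below `I^{1/p}` suffices.
  obtain ⟨κ, hκ0, hκ⟩ : ∃ κ : ℝ≥0, 0 < κ ∧ (κ : ℝ≥0∞) < I ^ (1 / p) := by
    have : 0 < I ^ (1 / p) := ENNReal.rpow_pos_of_nonneg hI0 (by positivity)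
    obtain ⟨κ, h1, h2⟩ := ENNReal.lt_iff_exists_nnreal_btwn.mp this
    exact ⟨κ, by exact_mod_cast h1, h2⟩
  refine ⟨κ, hκ0, fun A f hA hf => ?_⟩
  rw [weightedNorm_eq_lintegral hp]
  calc ENNReal.ofReal (A * κ) = ENNReal.ofReal A * κ := by
        rw [ENNReal.ofReal_mul hA, ENNReal.ofReal_coe_nnreal]
    _ ≤ ENNReal.ofReal A * I ^ (1 / p) := by gcongr
    _ = (I * ENNReal.ofReal A ^ p) ^ (1 / p) := by
        rw [ENNReal.mul_rpow_of_nonneg _ _ (by positivity), ← ENNReal.rpow_mul,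
          mul_one_div_cancel hp.ne', ENNReal.rpow_one, mul_comm]
    _ ≤ _ := by
        gcongr
        rw [hI, ← lintegral_mul_const _ (measurable_ofReal_norm_rpow a)]
        refine le_trans ?_ (setLIntegral_le_lintegral (Metric.ball x₀ δ) _)
        refine setLIntegral_mono' measurableSet_ball fun x hx => ?_
        gcongr
        rw [← ofReal_norm]
        exact ENNReal.ofReal_le_ofReal (hf x hx)

/-- A pointwise replacement for Hölder's inequality in passing from `L^q` to `L²`; this is where `q
≤ 2` enters. -/
theorem rpow_le_one_add_sq {y q : ℝ} (hy : 0 ≤ y) (hq0 : 0 ≤ q) (hq : q ≤ 2) :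
    y ^ q ≤ 1 + y ^ 2 := by
  rcases le_total y 1 with h | h
  · have := Real.rpow_le_one hy h hq0
    nlinarith [sq_nonneg y]
  · have := Real.rpow_le_rpow_of_exponent_le h hq
    rw [Real.rpow_two] at this
    linarith

/-- The function with Fourier transform `∂_e^n (e^{-iτφ} χ)` lives at scale `τ` and vanishes to
high order at the origin; here is the resulting bound of its norm in `L^q(|x|^{qs})`. -/
theorem exists_weightedNorm_fourierInv_le (hn : 1 ≤ n) (φ : 𝓢(Rn n, ℝ)) (χ : 𝓢(Rn n, ℂ))
    (hχ : HasCompactSupport χ) {e : Rn n} (he : ‖e‖ = 1) {q s : ℝ} (hq1 : 1 < q) (hq2 : q ≤ 2)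
    (hs : -(n : ℝ) < s) (hs0 : s < 0) :
    ∃ C : ℝ, 0 ≤ C ∧ ∀ τ : ℝ, 1 ≤ τ →
      weightedNorm q (fun x => ‖x‖ ^ (q * s))
        (𝓕⁻ ((lineDerivOp e : 𝓢(Rn n, ℂ) → 𝓢(Rn n, ℂ))^[n] (modulate φ χ hχ τ)) :
          𝓢(Rn n, ℂ)) ≤
      ENNReal.ofReal (C * τ ^ (s + n / 2 + n / q)) := by
  -- The moment has order `2(2n+1) = 2n + 2(n+1)`: `u^n` pays for the factor `|x|^n`, and `u^{n+1}`
  -- for the integrable tail `u^{-(n+1)}`, both squared.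
  obtain ⟨C₁, hC₁, hH⟩ := exists_lintegral_weight_fourierInv_modulate_le φ χ hχ (2 * n)
  have hfin : ∫⁻ x : Rn n, ENNReal.ofReal ((1 + ‖x‖) ^ (-((n : ℝ) + 1))) < ⊤ :=
    finite_integral_one_add_norm (by simp)
  set J := ∫⁻ x : Rn n, ENNReal.ofReal ((1 + ‖x‖) ^ (-((n : ℝ) + 1))) with hJ
  set A : ℝ := (2 * Real.pi) ^ n with hA
  have hA0 : 0 < A := by positivity
  have hq0 : 0 < q := by linarith
  refine ⟨A * (J.toReal + C₁) ^ (1 / q), by positivity, fun τ hτ => ?_⟩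
  have hτ0 : 0 < τ := by linarith
  set H := 𝓕⁻ (modulate φ χ hχ τ) with hHdef
  set F := 𝓕⁻ ((lineDerivOp e : 𝓢(Rn n, ℂ) → 𝓢(Rn n, ℂ))^[n] (modulate φ χ hχ τ)) with hF
  have hFH : ∀ x, ‖F x‖ ≤ A * ‖x‖ ^ n * ‖H x‖ := by
    intro x
    rw [hF, fourierInv_iterate_lineDerivOp, norm_mul, norm_pow, norm_mul, norm_neg, norm_mul,
      norm_mul, Complex.norm_I, Complex.norm_real, Complex.norm_real, Complex.norm_ofNat,
      Real.norm_of_nonneg Real.pi_pos.le, mul_one, hA, ← mul_pow]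
    gcongr
    simpa [he] using norm_inner_le_norm (𝕜 := ℝ) x e
  have hpt : ∀ x : Rn n, ENNReal.ofReal (‖x‖ ^ (q * s)) * ‖F x‖ₑ ^ q ≤
      ENNReal.ofReal ((A * τ ^ (s + n / 2)) ^ q) *
        (ENNReal.ofReal ((1 + ‖τ⁻¹ • x‖) ^ (-((n : ℝ) + 1))) +
          ENNReal.ofReal (τ ^ (n : ℝ)) *
            ENNReal.ofReal ((1 + ‖x‖ / τ) ^ (2 * (2 * n + 1)) * ‖H x‖ ^ 2)) := by
    intro x
    have hux : ‖τ⁻¹ • x‖ = ‖x‖ / τ := by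
      rw [norm_smul, norm_inv, Real.norm_of_nonneg hτ0.le, div_eq_inv_mul]
    rw [hux, ← ofReal_norm, ENNReal.ofReal_rpow_of_nonneg (norm_nonneg _) hq0.le,
      ← ENNReal.ofReal_mul (by positivity), ← ENNReal.ofReal_mul (by positivity),
      ← ENNReal.ofReal_add (by positivity) (by positivity), ← ENNReal.ofReal_mul (by positivity)]
    refine ENNReal.ofReal_le_ofReal ?_
    set u := 1 + ‖x‖ / τ with hu
    have hu1 : 1 ≤ u := by
      have : 0 ≤ ‖x‖ / τ := by positivity
      linarith
    have hu0 : 0 < u := by linarith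
    -- `s + n > 0` gives boundedness near the origin, and `s < 0` lets `u^{s+n}` be replaced by
    -- `u^n`.
    have h1 : ‖x‖ ^ s * ‖x‖ ^ n ≤ τ ^ (s + n) * u ^ n := by
      rcases (norm_nonneg x).eq_or_lt with h0 | h0
      · rw [← h0, zero_pow (by omega), mul_zero]
        positivity
      · rw [← Real.rpow_natCast, ← Real.rpow_add h0]
        have e1 : ‖x‖ = τ * (‖x‖ / τ) := by field_simp
        rw [e1, Real.mul_rpow hτ0.le (by positivity)]
        gcongr
        calc (‖x‖ / τ) ^ (s + n) ≤ u ^ (s + n) := by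
              refine Real.rpow_le_rpow (by positivity) (by simp [hu]) (by linarith)
          _ ≤ u ^ (n : ℝ) := Real.rpow_le_rpow_of_exponent_le hu1 (by linarith)
          _ = u ^ n := Real.rpow_natCast _ _
    set y := τ ^ ((n : ℝ) / 2) * u ^ n * ‖H x‖ with hy
    have hy0 : 0 ≤ y := by positivity
    have h2 : ‖x‖ ^ s * ‖F x‖ ≤ A * τ ^ (s + n / 2) * y := by
      calc ‖x‖ ^ s * ‖F x‖ ≤ ‖x‖ ^ s * (A * ‖x‖ ^ n * ‖H x‖) := by
            gcongr
            exact hFH x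
        _ = A * (‖x‖ ^ s * ‖x‖ ^ n) * ‖H x‖ := by ring
        _ ≤ A * (τ ^ (s + n) * u ^ n) * ‖H x‖ := by gcongr
        _ = A * τ ^ (s + n / 2) * y := by
            have : τ ^ (s + n) = τ ^ (s + n / 2) * τ ^ ((n : ℝ) / 2) := by
              rw [← Real.rpow_add hτ0]
              ring_nf
            rw [this, hy]
            ring
    have h3 : y ^ q ≤ u ^ (-((n : ℝ) + 1)) +
        τ ^ (n : ℝ) * (u ^ (2 * (2 * n + 1)) * ‖H x‖ ^ 2) := by
      -- Splitting off `v = u^{-(n+1)} ≤ 1`, for which `v^q ≤ v`, makes the constant term in `1 +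
      -- (·)²` integrable.
      have hz : y = u ^ (-((n : ℝ) + 1)) * (u ^ (n + 1) * y) := by
        rw [Real.rpow_neg hu0.le, ← mul_assoc]
        rw [show (n : ℝ) + 1 = ((n + 1 : ℕ) : ℝ) by push_cast; ring, Real.rpow_natCast,
          inv_mul_cancel₀ (by positivity), one_mul]
      set v := u ^ (-((n : ℝ) + 1)) with hv
      have hv0 : 0 < v := by positivity
      have hv1 : v ≤ 1 := Real.rpow_le_one_of_one_le_of_nonpos hu1 (by
        have : (0 : ℝ) ≤ n := by positivity
        linarith)
      have hvq : v ^ q ≤ v := by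
        simpa using Real.rpow_le_rpow_of_exponent_ge hv0 hv1 hq1.le
      have hsq : (u ^ (n + 1) * y) ^ 2 = τ ^ (n : ℝ) * (u ^ (2 * (2 * n + 1)) * ‖H x‖ ^ 2) := by
        have : τ ^ (n : ℝ) = (τ ^ ((n : ℝ) / 2)) ^ 2 := by
          rw [← Real.rpow_natCast, ← Real.rpow_mul hτ0.le]
          norm_num
        rw [hy, this]
        ring
      calc y ^ q = v ^ q * (u ^ (n + 1) * y) ^ q := by
            conv_lhs => rw [hz]
            rw [Real.mul_rpow hv0.le (by positivity)]
        _ ≤ v * (1 + (u ^ (n + 1) * y) ^ 2) := by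
            gcongr
            exact rpow_le_one_add_sq (by positivity) hq0.le hq2
        _ ≤ v + (u ^ (n + 1) * y) ^ 2 := by nlinarith [sq_nonneg (u ^ (n + 1) * y)]
        _ = _ := by rw [hsq]
    calc ‖x‖ ^ (q * s) * ‖F x‖ ^ q = (‖x‖ ^ s * ‖F x‖) ^ q := by
          rw [Real.mul_rpow (by positivity) (by positivity), mul_comm q s,
            Real.rpow_mul (norm_nonneg _)]
      _ ≤ (A * τ ^ (s + n / 2) * y) ^ q := by gcongr
      _ = (A * τ ^ (s + n / 2)) ^ q * y ^ q := Real.mul_rpow (by positivity) hy0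
      _ ≤ _ := by gcongr
  rw [weightedNorm_eq_lintegral hq0]
  have hinteg : ∫⁻ x, ENNReal.ofReal (‖x‖ ^ (q * s)) * ‖F x‖ₑ ^ q ≤
      ENNReal.ofReal ((A * τ ^ (s + n / 2)) ^ q * (τ ^ (n : ℝ) * (J.toReal + C₁))) := by
    refine (lintegral_mono hpt).trans ?_
    rw [lintegral_const_mul' _ _ ENNReal.ofReal_ne_top, lintegral_add_left (by fun_prop),
      lintegral_const_mul' _ _ ENNReal.ofReal_ne_top,
      lintegral_comp_smul (inv_pos.mpr hτ0)
        (fun x : Rn n => ENNReal.ofReal ((1 + ‖x‖) ^ (-((n : ℝ) + 1)))),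
      Real.inv_rpow hτ0.le, Real.rpow_neg hτ0.le, inv_inv, ← mul_add,
      ENNReal.ofReal_mul (by positivity), ENNReal.ofReal_mul (by positivity),
      ENNReal.ofReal_add (by positivity) hC₁, ENNReal.ofReal_toReal hfin.ne]
    gcongr
    exact hH τ hτ
  refine (ENNReal.rpow_le_rpow hinteg (by positivity)).trans (le_of_eq ?_)
  rw [ENNReal.ofReal_rpow_of_nonneg (by positivity) (by positivity)]
  congr 1
  rw [Real.mul_rpow (by positivity) (by positivity), ← Real.rpow_mul (by positivity),
    mul_one_div_cancel hq0.ne', Real.rpow_one, Real.mul_rpow (by positivity) (by positivity),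
    ← Real.rpow_mul hτ0.le, Real.rpow_add hτ0 (s + n / 2), mul_one_div]
  ring

end WeightedNorm

/-! ### Images of the test functions. -/

section TestFunctions

variable {n : ℕ}

theorem oscSymbol_smul (ρ m : ℝ) {R : ℝ} (hR : 0 < R) (η : Rn n) :
    oscSymbol n ρ m (R • η) = ((R ^ m : ℝ) : ℂ) *
      (Complex.exp (Complex.I * ((R ^ (1 - ρ) * ‖η‖ ^ (1 - ρ) : ℝ) : ℂ)) * ((‖η‖ ^ m : ℝ) : ℂ)) := by
  rw [oscSymbol, norm_smul, Real.norm_of_nonneg hR.le, Real.mul_rpow hR.le (norm_nonneg _),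
    Real.mul_rpow hR.le (norm_nonneg _)]
  push_cast
  ring

theorem sum_fourierInv_apply (D : ℕ → 𝓢(Rn n, ℂ)) (k : ℕ) (τ : ℂ) (x : Rn n) :
    (𝓕⁻ (∑ i ∈ Finset.range k, τ ^ i • D i)) x =
      ∑ i ∈ Finset.range k, τ ^ i * (𝓕⁻ (D i)) x := by
  have h : 𝓕⁻ (∑ i ∈ Finset.range k, τ ^ i • D i) =
      ∑ i ∈ Finset.range k, τ ^ i • 𝓕⁻ (D i) := by
    simp [FourierTransform.fourierInv_sum, FourierTransform.fourierInv_smul]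
  rw [h, _root_.sum_apply]
  simp

/-- For the test functions `e^{-iτφ} χ` the phase of the symbol is cancelled, up to the derivatives
of the oscillating factor. -/
theorem exists_oscSymbol_mul_lineDerivOp_modulate (ρ m : ℝ) {e : Rn n} (he : ‖e‖ = 1)
    (φ : 𝓢(Rn n, ℝ)) (hφ : ∀ η ∈ Metric.closedBall e (1 / 2), φ η = ‖η‖ ^ (1 - ρ))
    (χ : 𝓢(Rn n, ℂ)) (hχ : HasCompactSupport χ)
    (hχs : tsupport χ ⊆ Metric.closedBall e (1 / 2)) (k : ℕ) :
    ∃ D : ℕ → 𝓢(Rn n, ℂ),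
      (∀ η ∈ Metric.closedBall e (1 / 2),
        D k η = ((‖η‖ ^ m : ℝ) : ℂ) * ((-(Complex.I * (fderiv ℝ φ η e : ℂ))) ^ k * χ η)) ∧
      (∀ η, χ η = 0 → D k η = 0) ∧
      ∀ R : ℝ, 0 < R → ∀ η, oscSymbol n ρ m (R • η) *
        (lineDerivOp e : 𝓢(Rn n, ℂ) → 𝓢(Rn n, ℂ))^[k] (modulate φ χ hχ (R ^ (1 - ρ))) η =
        ((R ^ m : ℝ) : ℂ) *
          (∑ i ∈ Finset.range (k + 1), ((R ^ (1 - ρ) : ℝ) : ℂ) ^ i • D i) η := by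
  obtain ⟨b, hb⟩ := exists_schwartz_eq_norm_rpow he m
  obtain ⟨c, hck, hc⟩ := exists_iterate_lineDerivOp_modulate φ χ hχ e k
  refine ⟨fun i => smulLeftCLM ℂ b (c i), fun η hη => ?_, fun η hη => ?_, fun R hR η => ?_⟩
  · simp [smulLeftCLM_apply_apply b.hasTemperateGrowth, hck, hb η hη]
  · simp [smulLeftCLM_apply_apply b.hasTemperateGrowth, hck, hη]
  · set τ : ℝ := R ^ (1 - ρ) with hτ
    have hsum : (∑ i ∈ Finset.range (k + 1), (τ : ℂ) ^ i • smulLeftCLM ℂ b (c i)) η =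
        (b η : ℂ) * ∑ i ∈ Finset.range (k + 1), (τ : ℂ) ^ i * c i η := by
      rw [_root_.sum_apply, Finset.mul_sum]
      refine Finset.sum_congr rfl fun i _ => ?_
      simp [smulLeftCLM_apply_apply b.hasTemperateGrowth]
      ring
    rw [hsum]
    by_cases hη : η ∈ Metric.closedBall e (1 / 2)
    · rw [hc, hφ η hη, hb η hη, oscSymbol_smul ρ m hR, ← hτ, Complex.exp_neg]
      have := Complex.exp_ne_zero (Complex.I * ((τ * ‖η‖ ^ (1 - ρ) : ℝ) : ℂ))
      generalize Complex.exp (Complex.I * ((τ * ‖η‖ ^ (1 - ρ) : ℝ) : ℂ)) = w at this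
      field_simp
    · have h0 : (lineDerivOp e : 𝓢(Rn n, ℂ) → 𝓢(Rn n, ℂ))^[k] (modulate φ χ hχ τ) η = 0 := by
        refine image_eq_zero_of_notMem_tsupport fun h => hη (hχs ?_)
        exact tsupport_modulate_subset φ χ hχ τ (tsupport_iterate_lineDerivOp_subset e k _ h)
      have h1 := hc τ η
      rw [h0, eq_comm, mul_eq_zero] at h1
      rw [h0, h1.resolve_left (Complex.exp_ne_zero _)]
      simp

/-- The images of the test functions under the multiplier are large on a fixed ball. -/
theorem exists_ball_le_norm_fourierInv (ρ m : ℝ) (hρ1 : ρ ≤ 1) {e : Rn n} (he : ‖e‖ = 1) (k : ℕ) :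
    ∃ (φ : 𝓢(Rn n, ℝ)) (χ : 𝓢(Rn n, ℂ)) (hχ : HasCompactSupport χ) (D : ℝ → 𝓢(Rn n, ℂ)),
      (∀ R : ℝ, 0 < R → ∀ η, oscSymbol n ρ m (R • η) *
        (lineDerivOp e : 𝓢(Rn n, ℂ) → 𝓢(Rn n, ℂ))^[k] (modulate φ χ hχ (R ^ (1 - ρ))) η =
        ((R ^ m : ℝ) : ℂ) * D R η) ∧
      ∃ x₀ : Rn n, ∃ δ > 0, ∃ c > 0, ∃ R₀ ≥ (1 : ℝ), ∀ R ≥ R₀, ∀ x ∈ Metric.ball x₀ δ,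
        c * (R ^ (1 - ρ)) ^ k ≤ ‖(𝓕⁻ (D R)) x‖ := by
  obtain ⟨φ, hφ⟩ := exists_schwartz_eq_norm_rpow he (1 - ρ)
  obtain ⟨χ, hχ, hχs, hχ0, χ', hχχ', hχ'0, hχ'e⟩ := exists_schwartz_cutoff e
  obtain ⟨D, hDk, hDk0, hD⟩ := exists_oscSymbol_mul_lineDerivOp_modulate ρ m he φ hφ χ hχ hχs k
  refine ⟨φ, χ, hχ, fun R => ∑ i ∈ Finset.range (k + 1), ((R ^ (1 - ρ) : ℝ) : ℂ) ^ i • D i, hD, ?_⟩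
  rcases hρ1.lt_or_eq with hρ | rfl
  -- The value at `0` is the integral of the leading coefficient, which is `(-i)^k` times a
  -- nonnegative function positive at `e`.
  · have hne : (𝓕⁻ (D k)) 0 ≠ 0 := by
      set g : Rn n → ℝ := fun η => ‖η‖ ^ m * ((fderiv ℝ φ η e) ^ k * χ' η) with hg
      have hpos : ∀ η ∈ Metric.ball e (1 / 2), 0 < fderiv ℝ φ η e := by
        intro η hη
        have hev : (φ : Rn n → ℝ) =ᶠ[nhds η] fun x => ‖x‖ ^ (1 - ρ) := by
          filter_upwards [Metric.isOpen_ball.mem_nhds hη] with y hy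
          exact hφ y (Metric.ball_subset_closedBall hy)
        rw [hev.fderiv_eq]
        have hη' := Metric.ball_subset_closedBall hη
        have h1 := half_le_norm_of_mem_closedBall he hη'
        have h2 := half_le_inner_of_mem_closedBall he hη'
        exact fderiv_norm_rpow_apply_pos (by linarith)
          (norm_pos_iff.mp (by linarith)) (by linarith)
      have hDg : ∀ η, D k η = (-Complex.I) ^ k * (g η : ℂ) := by
        intro η
        by_cases hη : η ∈ Metric.ball e (1 / 2)
        · rw [hDk η (Metric.ball_subset_closedBall hη), hχχ', hg]
          push_cast
          ring
        · have h0 := hχ0 η hη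
          rw [hDk0 η h0]
          have : χ' η = 0 := by simpa [hχχ'] using h0
          simp [hg, this]
      have hI : ((-Complex.I) ^ k) ≠ 0 := pow_ne_zero _ (by simp)
      -- `χ'` carries no regularity of its own; continuity of `g` is read off from the Schwartz
      -- function `D k`.
      have hgc : Continuous g := by
        have : ∀ η, g η = ((((-Complex.I) ^ k)⁻¹) * D k η).re := by
          intro η
          rw [hDg, inv_mul_cancel_left₀ hI, Complex.ofReal_re]
        rw [funext this]
        exact Complex.continuous_re.comp (continuous_const.mul (D k).continuous)
      have hgi : Integrable g := by
        have h1 : Integrable fun η => (g η : ℂ) := by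
          have := ((D k).integrable (μ := volume)).const_mul (((-Complex.I) ^ k)⁻¹)
          refine this.congr (Filter.Eventually.of_forall fun η => ?_)
          simp only [hDg, inv_mul_cancel_left₀ hI]
        exact h1.re
      have hg0 : 0 ≤ g := by
        intro η
        by_cases hη : η ∈ Metric.ball e (1 / 2)
        · have := hpos η hη
          have := hχ'0 η
          simp only [hg, Pi.zero_apply]
          positivity
        · have : χ' η = 0 := by simpa [hχχ'] using hχ0 η hη
          simp [hg, this]
      have hge : g e ≠ 0 := by
        have := hpos e (Metric.mem_ball_self (by norm_num))
        simp only [hg, he, hχ'e, Real.one_rpow, one_mul, mul_one]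
        positivity
      have hinteg : 0 < ∫ η, g η := hgc.integral_pos_of_hasCompactSupport_nonneg_nonzero ?_ hg0 hge
      · rw [fourierInv_coe, Real.fourierInv_eq']
        simp only [inner_zero_right, mul_zero, Complex.ofReal_zero, zero_mul, Complex.exp_zero,
          one_smul, hDg]
        rw [integral_const_mul, integral_complex_ofReal]
        exact mul_ne_zero hI (by exact_mod_cast hinteg.ne')
      · refine HasCompactSupport.of_support_subset_isCompact (isCompact_closedBall e (1 / 2))
          fun η hη => ?_
        by_contra hc
        have : χ' η = 0 := by
          simpa [hχχ'] using hχ0 η fun h => hc (Metric.ball_subset_closedBall h)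
        exact hη (by simp [hg, this])
    obtain ⟨δ, hδ, c, hc, T, hT, hb⟩ := exists_ball_le_norm_sum (fun i => 𝓕⁻ (D i)) k hne
    -- This threshold for `R` makes `τ = R^{1-ρ} ≥ T`.
    refine ⟨0, δ, hδ, c, hc, T ^ (1 - ρ)⁻¹, ?_, fun R hR x hx => ?_⟩
    · exact Real.one_le_rpow hT (by simpa using hρ.le)
    · rw [sum_fourierInv_apply]
      refine hb (R ^ (1 - ρ)) ?_ x hx
      have hT0 : 0 ≤ T := by linarith
      calc T = (T ^ (1 - ρ)⁻¹) ^ (1 - ρ) := by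
            rw [← Real.rpow_mul hT0, inv_mul_cancel₀ (by linarith), Real.rpow_one]
        _ ≤ R ^ (1 - ρ) := Real.rpow_le_rpow (by positivity) hR (by linarith)
  -- For `ρ = 1` one has `τ = 1` for all `R` and no term dominates, but the image profile `S` is
  -- fixed and need only be nonzero. The symbol has no zero on the support, so `S = 0` would force
  -- the modulated cutoff to vanish, although it has modulus `1` at `e`.
  · simp only [sub_self, Real.rpow_zero, Complex.ofReal_one, one_pow, one_smul, mul_one] at hD ⊢
    set S := ∑ i ∈ Finset.range (k + 1), D i with hS
    have hS0 : S ≠ 0 := by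
      intro h0
      have hz : (lineDerivOp e : 𝓢(Rn n, ℂ) → 𝓢(Rn n, ℂ))^[k] (modulate φ χ hχ 1) = 0 := by
        ext η
        by_cases hη : η ∈ Metric.closedBall e (1 / 2)
        · have h1 := hD 1 one_pos η
          rw [h0, one_smul] at h1
          have h2 : oscSymbol n 1 m η ≠ 0 := by
            have := half_le_norm_of_mem_closedBall he hη
            refine mul_ne_zero (Complex.exp_ne_zero _) ?_
            have : 0 < ‖η‖ := by linarith
            exact_mod_cast (by positivity : ‖η‖ ^ m ≠ 0)
          have h3 : oscSymbol n 1 m η *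
            (lineDerivOp e : 𝓢(Rn n, ℂ) → 𝓢(Rn n, ℂ))^[k] (modulate φ χ hχ 1) η = 0 := by
            simpa using h1
          exact (mul_eq_zero.mp h3).resolve_left h2
        · refine image_eq_zero_of_notMem_tsupport fun h => hη (hχs ?_)
          exact tsupport_modulate_subset φ χ hχ 1 (tsupport_iterate_lineDerivOp_subset e k _ h)
      have h4 := eq_zero_of_iterate_lineDerivOp_eq_zero he hz
      have h5 : modulate φ χ hχ 1 e = 0 := by rw [h4]; rfl
      rw [modulate_apply, hχχ', hχ'e] at h5
      simp at h5
    obtain ⟨x₀, hx₀⟩ : ∃ x₀, (𝓕⁻ S) x₀ ≠ 0 := by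
      by_contra! h
      have h1 : 𝓕⁻ S = 0 := by
        ext x
        exact h x
      refine hS0 ?_
      have h2 := congrArg (fun g : 𝓢(Rn n, ℂ) => 𝓕 g) h1
      simpa using h2
    obtain ⟨δ, hδ, hb⟩ := exists_ball_norm_ge_of_ne_zero (𝓕⁻ S).continuous hx₀
    exact ⟨x₀, δ, hδ, ‖(𝓕⁻ S) x₀‖ / 2, by simpa using hx₀, 1, le_rfl, fun R _ x hx => hb x hx⟩

end TestFunctions

/-! ### Comparison of powers of `R`. -/

theorem exponent_le_of_forall_rpow_le {α β K R₀ : ℝ}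
    (h : ∀ R ≥ R₀, R ^ α ≤ K * R ^ β) : α ≤ β := by
  by_contra! hlt
  have ht := tendsto_rpow_atTop (sub_pos.mpr hlt)
  obtain ⟨R, h1, h2, h3⟩ := ((ht.eventually_gt_atTop K).and
    ((Filter.eventually_ge_atTop R₀).and (Filter.eventually_gt_atTop 0))).exists
  have h4 := h R h2
  rw [Real.rpow_sub h3, lt_div_iff₀ (by positivity)] at h1
  linarith

/-- Boundedness for a single power weight already bounds the order of the symbol. -/
theorem order_le_of_isWeightedBounded {n : ℕ} (hn : 1 ≤ n) {p q ρ m s : ℝ} (hp : 0 < p)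
    (hq1 : 1 < q) (hq2 : q ≤ 2) (hρ1 : ρ ≤ 1) (hs : -(n : ℝ) < s) (hs0 : s < 0)
    (hb : IsWeightedBounded (oscSymbol n ρ m) q p
      (fun x => ‖x‖ ^ (q * s)) (fun x => ‖x‖ ^ (p * s))) :
    m ≤ n / p - n / q + (1 - ρ) * (s + n / q - n / 2) := by
  obtain ⟨C, hC⟩ := hb
  set e : Rn n := EuclideanSpace.single ⟨0, hn⟩ 1 with he_def
  have he : ‖e‖ = 1 := by simp [he_def]
  obtain ⟨φ, χ, hχ, D, hD, x₀, δ, hδ, c₀, hc₀, R₀, hR₀, hlow⟩ :=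
    exists_ball_le_norm_fourierInv ρ m hρ1 he n
  obtain ⟨C₁, hC₁, hup⟩ := exists_weightedNorm_fourierInv_le hn φ χ hχ he hq1 hq2 hs hs0
  obtain ⟨κ, hκ, hκle⟩ := exists_le_weightedNorm hp (p * s) hn x₀ hδ
  have hq0 : 0 < q := by linarith
  have hπ : 0 < 2 * Real.pi := by positivity
  have key : ∀ R ≥ R₀, R ^ (m + n / q - n / p) ≤
      (C * C₁ * (2 * Real.pi) ^ ((n : ℝ) / q - n / p) / (c₀ * κ)) *
        R ^ ((1 - ρ) * (s + n / q - n / 2)) := by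
    intro R hR
    have hR1 : 1 ≤ R := hR₀.trans hR
    have hR0 : 0 < R := by linarith
    set τ := R ^ (1 - ρ) with hτ
    have hτ1 : 1 ≤ τ := Real.one_le_rpow hR1 (by linarith)
    have hτ0 : 0 < τ := by linarith
    set c := (2 * Real.pi)⁻¹ * R with hc
    have hc0 : 0 < c := by positivity
    have hcR : 2 * Real.pi * c = R := by rw [hc, mul_inv_cancel_left₀ hπ.ne']
    set g := (lineDerivOp e : 𝓢(Rn n, ℂ) → 𝓢(Rn n, ℂ))^[n] (modulate φ χ hχ τ) with hg
    set F : 𝓢(Rn n, ℂ) := 𝓕⁻ g with hF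
    have hFF : 𝓕 (F : Rn n → ℂ) = g := by
      rw [← fourier_coe, hF, fourier_fourierInv_eq]
    set f : 𝓢(Rn n, ℂ) := compCLMOfContinuousLinearEquiv ℂ
      (ContinuousLinearEquiv.smulLeft (R₁ := ℝ) (M₁ := Rn n) (Units.mk0 c hc0.ne')) F with hf
    have hfc : (f : Rn n → ℂ) = fun x => F (c • x) := rfl
    have hmul : ∀ η, oscSymbol n ρ m (R • η) * g η = (((R ^ m : ℝ) : ℂ) • D R) η := by
      intro η
      rw [hD R hR0 η]
      rfl
    -- The transform of `f` vanishes near the origin, so the product is a rescaled Schwartz function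
    -- and `f` is admissible for every `m`.
    have hinteg : Integrable (fun ξ => oscSymbol n ρ m ξ * angularFourier f ξ) := by
      have h1 : (fun ξ => oscSymbol n ρ m ξ * angularFourier f ξ) = fun ξ =>
          ((c ^ n)⁻¹ : ℝ) * (((R ^ m : ℝ) : ℂ) • D R) (R⁻¹ • ξ) := by
        ext ξ
        rw [hfc, angularFourier_comp_smul F hc0, hcR, hFF, ← hmul, smul_inv_smul₀ hR0.ne']
        ring
      rw [h1]
      exact ((SchwartzMap.integrable _).comp_smul (inv_ne_zero hR0.ne')).const_mul _
    obtain ⟨G, hG⟩ : ∃ G : Rn n → ℂ, ∀ y, G y = ((R ^ m : ℝ) : ℂ) * (𝓕⁻ (D R)) y :=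
      ⟨_, fun _ => rfl⟩
    have hop : multiplierOp (oscSymbol n ρ m) f = fun x => G (c • x) := by
      ext x
      rw [hfc, multiplierOp_comp_smul _ _ hc0, hcR, hFF, funext hmul, ← fourierInv_coe,
        FourierTransform.fourierInv_smul, hG]
      rfl
    have hbound := hC f hinteg
    rw [hop, hfc, weightedNorm_comp_smul hp s G hc0, weightedNorm_comp_smul hq0 s _ hc0] at hbound
    have hleft := hκle (R ^ m * (c₀ * τ ^ n)) G (by positivity) fun x hx => by
        rw [hG, norm_mul, Complex.norm_real, Real.norm_of_nonneg (by positivity)]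
        gcongr
        exact hlow R hR x hx
    have hall : ENNReal.ofReal (c ^ (-(n : ℝ) / p - s) * (R ^ m * (c₀ * τ ^ n) * κ)) ≤
        ENNReal.ofReal (C * (c ^ (-(n : ℝ) / q - s) * (C₁ * τ ^ (s + n / 2 + n / q)))) := by
      rw [ENNReal.ofReal_mul (by positivity), ENNReal.ofReal_mul (p := (C : ℝ)) (by positivity),
        ENNReal.ofReal_mul (p := c ^ (-(n : ℝ) / q - s)) (by positivity),
        ENNReal.ofReal_coe_nnreal]
      refine (mul_le_mul_right hleft _).trans (hbound.trans ?_)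
      gcongr
      exact hup τ hτ1
    rw [ENNReal.ofReal_le_ofReal_iff (by positivity)] at hall
    have hc1 : c ^ (-(n : ℝ) / q - s) = c ^ (-(n : ℝ) / p - s) * c ^ ((n : ℝ) / p - n / q) := by
      rw [← Real.rpow_add hc0]
      ring_nf
    have hc2 : c ^ ((n : ℝ) / p - n / q) =
        (2 * Real.pi) ^ ((n : ℝ) / q - n / p) * (R ^ ((n : ℝ) / q - n / p))⁻¹ := by
      rw [hc, Real.mul_rpow (by positivity) hR0.le, Real.inv_rpow hπ.le, ← Real.rpow_neg hπ.le,
        ← Real.rpow_neg hR0.le]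
      ring_nf
    have hτ2 : τ ^ (s + n / 2 + n / q) = τ ^ n * τ ^ (s + n / q - n / 2) := by
      rw [← Real.rpow_natCast, ← Real.rpow_add hτ0]
      ring_nf
    have hτ3 : τ ^ (s + n / q - n / 2) = R ^ ((1 - ρ) * (s + n / q - n / 2)) := by
      rw [hτ, ← Real.rpow_mul hR0.le]
    have hR2 : R ^ (m + n / q - n / p) = R ^ m * R ^ ((n : ℝ) / q - n / p) := by
      rw [← Real.rpow_add hR0]
      ring_nf
    rw [hc1, hc2, hτ2, hτ3] at hall
    have hcp : 0 < c ^ (-(n : ℝ) / p - s) := by positivity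
    have hRp : 0 < R ^ ((n : ℝ) / q - n / p) := by positivity
    have hτn : 0 < τ ^ n := by positivity
    rw [hR2, div_mul_eq_mul_div, le_div_iff₀ (by positivity)]
    -- Both sides share the power of `c` and `τ^n`; only powers of `R` remain after cancellation.
    refine le_of_mul_le_mul_left (a := c ^ (-(n : ℝ) / p - s) * τ ^ n *
      (R ^ ((n : ℝ) / q - n / p))⁻¹) ?_ (by positivity)
    calc _ = c ^ (-(n : ℝ) / p - s) * (R ^ m * (c₀ * τ ^ n) * κ) := by field_simp
      _ ≤ _ := hall
      _ = _ := by ring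
  have := exponent_le_of_forall_rpow_le key
  linarith

end OscillatoryTestFunctions

/-! ### Power weights in reverse Hölder classes. -/

section ReverseHolder

variable {n : ℕ}

theorem cube_eq_preimage (c : Rn n) (ℓ : ℝ) :
    cube c ℓ = (WithLp.ofLp : Rn n → Fin n → ℝ) ⁻¹' Set.Icc c.ofLp (fun i => c i + ℓ) := by
  ext x
  simp only [cube, Set.mem_ofPred_eq, Set.mem_Icc, Set.mem_preimage, Pi.le_def, forall_and]

theorem measurableSet_cube (c : Rn n) (ℓ : ℝ) : MeasurableSet (cube c ℓ) := by
  rw [cube_eq_preimage]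
  exact (PiLp.volume_preserving_ofLp (Fin n)).measurable measurableSet_Icc

theorem volume_cube (c : Rn n) {ℓ : ℝ} (hℓ : 0 ≤ ℓ) : volume (cube c ℓ) = ENNReal.ofReal (ℓ ^ n) := by
  rw [cube_eq_preimage, (PiLp.volume_preserving_ofLp (Fin n)).measure_preimage
    measurableSet_Icc.nullMeasurableSet, Real.volume_Icc_pi]
  simp [ENNReal.ofReal_pow hℓ]

theorem norm_sub_le_of_mem_cube {c x y : Rn n} {ℓ : ℝ} (hℓ : 0 ≤ ℓ) (hx : x ∈ cube c ℓ)
    (hy : y ∈ cube c ℓ) : ‖x - y‖ ≤ n * ℓ := by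
  refine abs_le_of_sq_le_sq' ?_ (by positivity) |>.2
  rw [EuclideanSpace.real_norm_sq_eq]
  calc ∑ i, (x - y) i ^ 2 ≤ ∑ _i : Fin n, ℓ ^ 2 := by
        refine Finset.sum_le_sum fun i _ => ?_
        have h1 := hx i
        have h2 := hy i
        rw [Set.mem_Icc] at h1 h2
        rw [PiLp.sub_apply]
        exact sq_le_sq' (by linarith) (by linarith)
    _ = n * ℓ ^ 2 := by simp
    _ ≤ (n * ℓ) ^ 2 := by
        rw [mul_pow]
        gcongr
        exact_mod_cast Nat.le_self_pow two_ne_zero n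

theorem le_cubeMean_one {w : Rn n → ℝ} {Q : Set (Rn n)} (hQ0 : volume Q ≠ 0)
    (hQt : volume Q ≠ ⊤) {A : ℝ} (h : ∀ᵐ x ∂volume.restrict Q, A ≤ w x) :
    ENNReal.ofReal A ≤ cubeMean 1 w Q := by
  have h1 : ENNReal.ofReal A * volume Q ≤ ∫⁻ x in Q, ENNReal.ofReal (w x) := by
    rw [← setLIntegral_const]
    exact lintegral_mono_ae (h.mono fun x hx => ENNReal.ofReal_le_ofReal hx)
  simp only [cubeMean, ENNReal.rpow_one, div_one]
  calc ENNReal.ofReal A = (volume Q)⁻¹ * (ENNReal.ofReal A * volume Q) := by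
        rw [mul_left_comm, ENNReal.inv_mul_cancel hQ0 hQt, mul_one]
    _ ≤ _ := by gcongr

theorem cubeMean_le {t : ℝ} (ht : 0 < t) {w : Rn n → ℝ} {Q : Set (Rn n)} {B C : ℝ≥0∞}
    (h : (volume Q)⁻¹ * ∫⁻ x in Q, ENNReal.ofReal (w x) ^ t ≤ C * B ^ t) :
    cubeMean t w Q ≤ C ^ (1 / t) * B := by
  refine (ENNReal.rpow_le_rpow h (by positivity)).trans (le_of_eq ?_)
  rw [ENNReal.mul_rpow_of_nonneg _ _ (by positivity), ← ENNReal.rpow_mul,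
    mul_one_div_cancel ht.ne', ENNReal.rpow_one]

theorem setLIntegral_ball_norm_rpow {r : ℝ} (hr : 0 < r) (a : ℝ) :
    ∫⁻ x in Metric.ball (0 : Rn n) r, ENNReal.ofReal (‖x‖ ^ a) =
      ENNReal.ofReal (r ^ ((n : ℝ) + a)) *
        ∫⁻ x in Metric.ball (0 : Rn n) 1, ENNReal.ofReal (‖x‖ ^ a) := by
  rw [← lintegral_indicator measurableSet_ball, ← lintegral_indicator measurableSet_ball]
  have h := lintegral_comp_smul (inv_pos.mpr hr)
    ((Metric.ball (0 : Rn n) 1).indicator fun x => ENNReal.ofReal (‖x‖ ^ a))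
  rw [Real.inv_rpow hr.le, Real.rpow_neg hr.le, inv_inv] at h
  rw [Real.rpow_add hr, mul_comm (r ^ (n : ℝ)), ENNReal.ofReal_mul (by positivity), mul_assoc, ← h,
    ← lintegral_const_mul' _ _ ENNReal.ofReal_ne_top]
  refine lintegral_congr fun x => ?_
  have hmem : r⁻¹ • x ∈ Metric.ball (0 : Rn n) 1 ↔ x ∈ Metric.ball (0 : Rn n) r := by
    rw [mem_ball_zero_iff, mem_ball_zero_iff, norm_smul, norm_inv, Real.norm_of_nonneg hr.le,
      inv_mul_lt_iff₀ hr, mul_one]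
  by_cases hx : x ∈ Metric.ball (0 : Rn n) r
  · rw [Set.indicator_of_mem hx, Set.indicator_of_mem (hmem.mpr hx),
      ← ENNReal.ofReal_mul (by positivity), norm_smul, norm_inv, Real.norm_of_nonneg hr.le,
      Real.mul_rpow (by positivity) (norm_nonneg _), Real.inv_rpow hr.le,
      mul_inv_cancel_left₀ (by positivity)]
  · rw [Set.indicator_of_notMem hx, Set.indicator_of_notMem (mt hmem.mp hx), mul_zero]

theorem inv_mul_le_of_le {A x y C : ℝ≥0∞} (hA0 : A ≠ 0) (hAt : A ≠ ⊤) (hx : A ≤ x)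
    (hy : y ≤ C * A) : x⁻¹ * y ≤ C := by
  calc x⁻¹ * y ≤ A⁻¹ * (C * A) := by gcongr
    _ = C := by rw [mul_left_comm, ENNReal.inv_mul_cancel hA0 hAt, mul_one]

/-- The weight `|x|^{-β}` belongs to `RH_t` if `βt < n`. -/
theorem isReverseHolder_norm_rpow (hn : 1 ≤ n) {β t : ℝ} (hβ : 0 < β) (ht : 1 ≤ t)
    (hβt : β * t < n) : IsReverseHolder t (fun x : Rn n => ‖x‖ ^ (-β)) := by
  have : Nonempty (Fin n) := ⟨⟨0, hn⟩⟩
  have ht0 : 0 < t := by linarith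
  have hn0 : (0 : ℝ) < n := by exact_mod_cast hn
  have hae : ∀ᵐ x : Rn n, x ≠ 0 := by
    rw [ae_iff]
    simp
  refine ⟨?_, ?_, ?_⟩
  · refine locallyIntegrable_of_norm_le_rpow (C := 1) (α := β) (by simpa using hn)
      (by rw [finrank_euclideanSpace_fin]; nlinarith) ?_
      (Measurable.aestronglyMeasurable (by fun_prop))
    refine Filter.Eventually.of_forall fun x => ?_
    rw [one_mul, Real.norm_of_nonneg (by positivity)]
  · filter_upwards [hae] with x hx
    have := norm_pos_iff.mpr hx
    positivity
  · set K := ∫⁻ x in Metric.ball (0 : Rn n) 1, ENNReal.ofReal (‖x‖ ^ (-(β * t))) with hK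
    have hKfin : K < ⊤ := by
      have h1 : IntegrableOn (fun x : Rn n => ‖x‖ ^ (-(β * t))) (Metric.ball 0 1) := by
        refine integrableOn_ball_of_norm_le_rpow (C := 1) (α := β * t) (by simpa using hn)
          (by simpa using hβt) ?_
          (Measurable.aestronglyMeasurable (by fun_prop))
        refine Filter.Eventually.of_forall fun x => ?_
        rw [one_mul, Real.norm_of_nonneg (by positivity)]
      exact h1.lintegral_lt_top
    have hwt : ∀ x : Rn n, ENNReal.ofReal (‖x‖ ^ (-β)) ^ t = ENNReal.ofReal (‖x‖ ^ (-(β * t))) := by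
      intro x
      rw [ENNReal.ofReal_rpow_of_nonneg (by positivity) ht0.le, ← Real.rpow_mul (norm_nonneg _),
        neg_mul]
    set C₁ : ℝ≥0∞ := (ENNReal.ofReal ((4 * n) ^ (n : ℝ)) * K) ^ (1 / t) with hC₁
    set C₂ : ℝ≥0∞ := ENNReal.ofReal (4 ^ β) with hC₂
    have hfin : max C₁ C₂ < ⊤ := by
      refine max_lt ?_ ENNReal.ofReal_lt_top
      exact ENNReal.rpow_lt_top_of_nonneg (by positivity)
        (ENNReal.mul_lt_top ENNReal.ofReal_lt_top hKfin).ne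
    refine lt_of_le_of_lt ?_ hfin
    refine iSup_le fun c => iSup_le fun ℓ => iSup_le fun hℓ => ?_
    set Q := cube c ℓ with hQ
    have hvol : volume Q = ENNReal.ofReal (ℓ ^ n) := volume_cube c hℓ.le
    have hQ0 : volume Q ≠ 0 := by
      rw [hvol]
      simp only [ne_eq, ENNReal.ofReal_eq_zero, not_le]
      positivity
    have hQt : volume Q ≠ ⊤ := by
      rw [hvol]
      exact ENNReal.ofReal_ne_top
    have hQm : MeasurableSet Q := measurableSet_cube c ℓ
    set d : ℝ := n * ℓ with hd
    have hd0 : 0 < d := by positivity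
    have hcQ : c ∈ Q := fun i => by simp [hℓ.le]
    have hdist : ∀ x ∈ Q, ‖x - c‖ ≤ d := fun x hx => norm_sub_le_of_mem_cube hℓ.le hx hcQ
    have hup : ∀ x ∈ Q, ‖x‖ ≤ ‖c‖ + d := fun x hx => by
      have := norm_le_norm_add_norm_sub' x c
      have := hdist x hx
      linarith
    have hlo : ∀ x ∈ Q, ‖c‖ - d ≤ ‖x‖ := fun x hx => by
      have := norm_le_norm_add_norm_sub x c
      have := hdist x hx
      linarith
    have hge : ∀ r : ℝ, (∀ x ∈ Q, ‖x‖ ≤ r) →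
        ENNReal.ofReal (r ^ (-β)) ≤ cubeMean 1 (fun x : Rn n => ‖x‖ ^ (-β)) Q := by
      intro r hr
      refine le_cubeMean_one hQ0 hQt ?_
      -- The origin is excluded because `0 ^ (-β) = 0` by convention, which would break the lower
      -- bound there.
      filter_upwards [ae_restrict_mem hQm, ae_restrict_of_ae hae] with x hx hx0
      exact Real.rpow_le_rpow_of_nonpos (norm_pos_iff.mpr hx0) (hr x hx) (by linarith)
    -- Cubes near the origin lie in the ball of radius `4d = 4nℓ`, where scaling yields `C₁`. On the
    -- remaining cubes `‖c‖/2 ≤ ‖x‖ ≤ 2‖c‖`, so the weight varies by a factor of at most `4^β = C₂`.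
    rcases le_total ‖c‖ (2 * d) with hc | hc
    · refine le_trans ?_ (le_max_left _ _)
      have h4 : 0 < 4 * d := by positivity
      refine inv_mul_le_of_le (A := ENNReal.ofReal ((4 * d) ^ (-β))) ?_ ENNReal.ofReal_ne_top
        (hge _ fun x hx => by have := hup x hx; linarith) ?_
      · simp only [ne_eq, ENNReal.ofReal_eq_zero, not_le]
        positivity
      · refine cubeMean_le ht0 ?_
        simp_rw [hwt]
        have hsub : Q ⊆ Metric.ball 0 (4 * d) := fun x hx => by
          rw [mem_ball_zero_iff]
          have := hup x hx
          linarith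
        calc (volume Q)⁻¹ * ∫⁻ x in Q, ENNReal.ofReal (‖x‖ ^ (-(β * t)))
            ≤ (volume Q)⁻¹ * (ENNReal.ofReal ((4 * d) ^ ((n : ℝ) + -(β * t))) * K) := by
              gcongr
              rw [hK, ← setLIntegral_ball_norm_rpow h4]
              exact lintegral_mono_set hsub
          _ = _ := by
              rw [hvol, ← ENNReal.ofReal_inv_of_pos (by positivity), ← mul_assoc,
                ← ENNReal.ofReal_mul (by positivity), mul_right_comm,
                ENNReal.ofReal_rpow_of_nonneg (by positivity) ht0.le,
                ← ENNReal.ofReal_mul (by positivity)]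
              congr 2
              rw [Real.rpow_add h4, ← Real.rpow_mul h4.le, neg_mul, ← mul_assoc]
              congr 1
              rw [hd, ← mul_assoc, Real.mul_rpow (by positivity) hℓ.le, Real.rpow_natCast ℓ]
              field_simp
    · refine le_trans ?_ (le_max_right _ _)
      have hc0 : 0 < ‖c‖ := by linarith
      refine inv_mul_le_of_le (A := ENNReal.ofReal ((2 * ‖c‖) ^ (-β))) ?_ ENNReal.ofReal_ne_top
        (hge _ fun x hx => by have := hup x hx; linarith) ?_
      · simp only [ne_eq, ENNReal.ofReal_eq_zero, not_le]
        positivity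
      · have hB : C₂ * ENNReal.ofReal ((2 * ‖c‖) ^ (-β)) = ENNReal.ofReal ((‖c‖ / 2) ^ (-β)) := by
          rw [hC₂, ← ENNReal.ofReal_mul (by positivity)]
          congr 1
          rw [show ‖c‖ / 2 = 4⁻¹ * (2 * ‖c‖) by ring,
            Real.mul_rpow (by norm_num : (0 : ℝ) ≤ 4⁻¹) (by positivity),
            Real.inv_rpow (by norm_num), Real.rpow_neg (by norm_num : (0 : ℝ) ≤ 4), inv_inv]
        have h := cubeMean_le (C := 1) (B := ENNReal.ofReal ((‖c‖ / 2) ^ (-β))) ht0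
          (w := fun x : Rn n => ‖x‖ ^ (-β)) (Q := Q) ?_
        · simpa [hB] using h
        · calc _ ≤ (volume Q)⁻¹ * ∫⁻ _ in Q, ENNReal.ofReal ((‖c‖ / 2) ^ (-β)) ^ t := by
                gcongr (volume Q)⁻¹ * ?_
                refine setLIntegral_mono' hQm fun x hx => ?_
                refine ENNReal.rpow_le_rpow (ENNReal.ofReal_le_ofReal ?_) ht0.le
                refine Real.rpow_le_rpow_of_nonpos (by positivity) ?_ (by linarith)
                have := hlo x hx
                linarith
            _ = _ := by
                rw [setLIntegral_const, mul_left_comm, ENNReal.inv_mul_cancel hQ0 hQt, mul_one,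
                  one_mul]

end ReverseHolder

/-! ### Exponents and conclusion. -/

/-- Positivity combines `1/p ≥ 1 - 1/q` with `1/r > 1/q`. The case `r = 1` is separate because `r' =
∞`. -/
theorem mul_rhExponent {p q r : ℝ} (hq : 1 < q) (hqp : q ≤ p) (hpq : p ≤ Real.conjExponent q)
    (hr : 1 ≤ r) (hrq : r < q) :
    0 < 1 / p + 1 / r - 1 ∧ q * rhExponent p q r = (1 / p + 1 / r - 1)⁻¹ := by
  have hp0 : 0 < p := by linarith
  have hq0 : 0 < q := by linarith
  have hr0 : 0 < r := by linarith
  have hpos : 0 < 1 / p + 1 / r - 1 := by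
    have h1 : 1 - 1 / q ≤ 1 / p := by
      rw [Real.conjExponent, le_div_iff₀ (by linarith)] at hpq
      rw [← sub_nonneg]
      have : 1 / p - (1 - 1 / q) = (q - p * (q - 1)) / (p * q) := by
        field_simp
      rw [this]
      exact div_nonneg (by linarith) (by positivity)
    have h2 : 1 / q < 1 / r := one_div_lt_one_div_of_lt hr0 hrq
    linarith
  refine ⟨hpos, ?_⟩
  rw [rhExponent]
  rcases hr.eq_or_lt with rfl | hr1
  · have h1 : ENNReal.conjExponent (ENNReal.ofReal 1) = ⊤ := by simp [ENNReal.conjExponent]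
    have h2 : ENNReal.conjExponent ⊤ = 1 := by simp [ENNReal.conjExponent]
    rw [h1, ENNReal.top_div_of_ne_top ENNReal.ofReal_ne_top, h2, ENNReal.toReal_one]
    field_simp
    simp
  · have h1 : ENNReal.conjExponent (ENNReal.ofReal r) = ENNReal.ofReal (r / (r - 1)) := by
      rw [ENNReal.conjExponent, ← ENNReal.ofReal_one, ← ENNReal.ofReal_sub _ zero_le_one,
        ← ENNReal.ofReal_inv_of_pos (by linarith),
        ← ENNReal.ofReal_add zero_le_one (by simpa using hr1.le)]
      congr 1
      have : r - 1 ≠ 0 := by linarith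
      field_simp
      ring
    set x := r / (r - 1) / p with hx
    have hx1 : x - 1 = (1 / p + 1 / r - 1) * (r / (r - 1)) := by
      have : r - 1 ≠ 0 := by linarith
      rw [hx]
      field_simp
      ring
    have hrr : 0 < r / (r - 1) := div_pos hr0 (by linarith)
    have hx2 : 0 < x - 1 := by
      rw [hx1]
      positivity
    have h2 : ENNReal.conjExponent (ENNReal.ofReal x) = ENNReal.ofReal (1 + (x - 1)⁻¹) := by
      rw [ENNReal.conjExponent, ← ENNReal.ofReal_one, ← ENNReal.ofReal_sub _ zero_le_one,
        ← ENNReal.ofReal_inv_of_pos hx2, ← ENNReal.ofReal_add zero_le_one (by positivity)]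
    rw [h1, ← ENNReal.ofReal_div_of_pos hp0, h2, ENNReal.toReal_ofReal (by positivity)]
    have h3 : 1 + (x - 1)⁻¹ = x * (x - 1)⁻¹ := by field_simp; ring
    rw [h3, hx1, hx]
    field_simp

theorem proposition3p3 (n : ℕ) (hn : 1 ≤ n) (p q ρ m : ℝ) (hq : 1 < q) (hqp : q ≤ p)
    (hpq : p ≤ Real.conjExponent q) (hρ0 : 0 < ρ) (hρ1 : ρ ≤ 1) :
    (∀ γ : ℝ, 1 ≤ γ →
      (∀ s ∈ Set.Ioo (-(n : ℝ) / γ) 0,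
        IsWeightedBounded (oscSymbol n ρ m) q p
          (fun x => ‖x‖ ^ (q * s)) (fun x => ‖x‖ ^ (p * s))) →
      m ≤ -(n : ℝ) * (1 - ρ) * (1 / 2 - 1 / p) - ρ * n * (1 / q - 1 / p)
        - n * (1 - ρ) / γ) ∧
    (∀ r : ℝ, 1 ≤ r → r < q →
      (∀ ω : Rn n → ℝ, (∀ x, 0 ≤ ω x) →
        IsReverseHolder (rhExponent p q r) (fun x => ω x ^ q) →
        IsWeightedBounded (oscSymbol n ρ m) q p
          (fun x => ω x ^ q) (fun x => ω x ^ p)) →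
      m ≤ -(n : ℝ) * (1 - ρ) * (1 / r - 1 / 2) - ρ * n * (1 / q - 1 / p)) := by
  have hp0 : 0 < p := by linarith
  have hq0 : 0 < q := by linarith
  have hn0 : (0 : ℝ) < n := by exact_mod_cast hn
  have hq2 : q ≤ 2 := by
    have h := hqp.trans hpq
    rw [Real.conjExponent, le_div_iff₀ (by linarith)] at h
    nlinarith
  have main : ∀ γ : ℝ, 1 ≤ γ →
      (∀ s ∈ Set.Ioo (-(n : ℝ) / γ) 0,
        IsWeightedBounded (oscSymbol n ρ m) q p
          (fun x => ‖x‖ ^ (q * s)) (fun x => ‖x‖ ^ (p * s))) →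
      m ≤ -(n : ℝ) * (1 - ρ) * (1 / 2 - 1 / p) - ρ * n * (1 / q - 1 / p)
        - n * (1 - ρ) / γ := by
    intro γ hγ hb
    have hγ0 : 0 < γ := by linarith
    have hnγ : (n : ℝ) / γ ≤ n := div_le_self hn0.le hγ
    have hnγ0 : 0 < (n : ℝ) / γ := by positivity
    refine le_of_forall_pos_le_add fun ε hε => ?_
    -- The endpoint `-n/γ` is not allowed; the minimum keeps `s` negative and within `ε` of it.
    set s := -(n : ℝ) / γ + min (n / γ / 2) ε with hs
    have hmin0 : 0 < min ((n : ℝ) / γ / 2) ε := lt_min (by positivity) hε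
    have hmin1 := min_le_left ((n : ℝ) / γ / 2) ε
    have hmin2 := min_le_right ((n : ℝ) / γ / 2) ε
    have hneg : -(n : ℝ) / γ = -(n / γ) := neg_div _ _
    have hs0 : s < 0 := by linarith
    have hs1 : -(n : ℝ) / γ < s := by linarith
    have h := order_le_of_isWeightedBounded hn hp0 hq hq2 hρ1 (by linarith) hs0
      (hb s ⟨hs1, hs0⟩)
    have h2 : (1 - ρ) * s ≤ (1 - ρ) * (-(n : ℝ) / γ) + ε := by
      rw [hs, mul_add]
      nlinarith
    calc m ≤ n / p - n / q + (1 - ρ) * (n / q - n / 2) + (1 - ρ) * s := by linarith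
      _ ≤ n / p - n / q + (1 - ρ) * (n / q - n / 2) + ((1 - ρ) * (-(n : ℝ) / γ) + ε) := by gcongr
      _ = _ := by ring
  refine ⟨main, fun r hr hrq hb => ?_⟩
  obtain ⟨hpos, hqt⟩ := mul_rhExponent hq hqp hpq hr hrq
  set t := rhExponent p q r with ht
  have hinv : 1 / p + 1 / r - 1 ≤ 1 / q := by
    have h1 : 1 / r ≤ 1 := by
      rw [div_le_one (by linarith)]
      exact hr
    have h2 : 1 / p ≤ 1 / q := one_div_le_one_div_of_le hq0 hqp
    linarith
  have hqt1 : q ≤ q * t := by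
    rw [hqt]
    have := one_div_le_one_div_of_le hpos hinv
    simpa using this
  have ht1 : 1 ≤ t := by nlinarith
  -- Part (i) with `γ = qt` and `ω = |x|^s`: the condition `s > -n/(qt)` is exactly `βt < n` for `β
  -- = -qs`.
  have h := main (q * t) (by linarith) fun s hs => ?_
  · have h1 : n * (1 - ρ) / (q * t) = n * (1 - ρ) * (1 / p + 1 / r - 1) := by
      rw [hqt, div_inv_eq_mul]
    rw [h1] at h
    refine h.trans (le_of_eq ?_)
    ring
  · obtain ⟨hs1, hs0⟩ := hs
    have hqt0 : 0 < q * t := by linarith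
    rw [div_lt_iff₀ hqt0] at hs1
    have hw : ∀ a : ℝ, (fun x : Rn n => (‖x‖ ^ s) ^ a) = fun x => ‖x‖ ^ (a * s) := by
      intro a
      ext x
      rw [← Real.rpow_mul (norm_nonneg _), mul_comm]
    have hbs := hb (fun x => ‖x‖ ^ s) (fun x => by positivity) ?_
    · rwa [hw, hw] at hbs
    · rw [hw]
      have := isReverseHolder_norm_rpow (n := n) hn (β := -(q * s)) (t := t) (by nlinarith) ht1
        (by nlinarith)
      simpa using this
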